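/- **Setting.** Write $\omega(\tau)=\tau-\ln(1+\tau)$ for $\tau\ge 0$ and $\omega_*(\tau)=-\tau-\ln(1-\tau)$ for $\tau\in[0,1)$. For a symmetric positive definite matrix $Q$ write $\|v\|_Q=(v^\top Qv)^{1/2}$, and let $\preceq$ be the Loewner order. Let $\varphi:\mathbb R^n\to\mathbb R\cup\{+\infty\}$ be proper, closed and convex with open domain, $C^3$ on $\mathrm{dom}\,\varphi$, with $\nabla^2\varphi(u)\succ0$ for all $u\in\mathrm{dom}\,\varphi$, and standard self-concordant: for all $u\in\mathrm{dom}\,\varphi$ and $v\in\mathbb R^n$ the function $h(\tau)=\varphi(u+\tau v)$ satisfies $|h'''|\le 2(h'')^{3/2}$ on its domain. Let $A\in\mathbb R^{p\times n}$ and $$f(x)=\max_{u\in\mathrm{dom}\,\varphi}\{\langle u,A^\top x\rangle-\varphi(u)\},\qquad \mathrm{dom}f=\{x\in\mathbb R^p:\ \varphi(u)-\langle u,A^\top x\rangle\text{ is bounded below on }\mathrm{dom}\,\varphi\},$$ and let $u^*(x)=\arg\min_{u\in\mathrm{dom}\,\varphi}\{\varphi(u)-\langle u,A^\top x\rangle\}$.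 For $x\in\mathrm{dom}f$ and $\delta\ge0$, a point $\tilde u\in\mathrm{dom}\,\varphi$ is a *$\delta$-solution at $x$* if $u^*(x)$ exists and $\|\tilde u-u^*(x)\|_{\nabla^2\varphi(\tilde u)}\le\delta$. For a convex function $f$, a triple $(\check f,g,H)$ of maps defined on $\mathrm{dom} f$, with values in $\mathbb R$, $\mathbb R^p$ and the symmetric $p\times p$ matrices, is a *$(\delta_0,\delta_1)$-global inexact oracle* of $f$, where $\delta_0\in[0,1]$ and $\delta_1\ge0$, if for all $x\in\mathrm{dom}f$ we have $H(x)\succ0$, and every $y\in\mathbb R^p$ with $r:=\|y-x\|_{H(x)}<\frac1{1+\delta_0}$ lies in $\mathrm{dom}f$ and satisfies $$\omega((1-\delta_0)r)\le f(y)-\check f(x)-\langle g(x),y-x\rangle\le\omega_*((1+\delta_0)r)+\delta_1 .$$ For $\delta_2,\delta_3\ge 0$ with $2\delta_2+\delta_3<1$ put $$\underline c=\sqrt{(1-\delta_2-\delta_3)^2+(1-\delta_3)(1-2\delta_2-\delta_3)},\qquad \bar c=\sqrt{9(1+\delta_2+\delta_3)^2-3(1+\delta_3)(1+2\delta_2+\delta_3)},$$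 $$\underline\psi^*(\delta_2,\delta_3)=\frac{\delta_2}{(1-\delta_2-\delta_3)+\underline c}-\ln\Big(1+\frac{2\delta_2}{(2-3\delta_2-2\delta_3)+\underline c}\Big),$$ $$\bar\psi^*(\delta_2,\delta_3)=\frac{3\delta_2}{3(1+\delta_2+\delta_3)+\bar c}-\ln\Big(1+\frac{2\delta_2}{(2+\delta_2+2\delta_3)+\bar c}\Big).$$ **Lemma.** (a) Let $A$ have full row rank $p$, let $0\le\delta\le0.292$, and for every $x\in\mathrm{dom}f$ let $\tilde u^*(x)$ be a $\delta$-solution at $x$. Put $$\tilde f(x)=\langle\tilde u^*(x),A^\top x\rangle-\varphi(\tilde u^*(x)),\quad g(x)=A\tilde u^*(x),\quad H(x)=A[\nabla^2\varphi(\tilde u^*(x))]^{-1}A^\top,$$ $\delta_3=\frac{\delta}{1-\delta}$, $\varepsilon=\omega_*(\delta_3)$, $\delta_0=2\delta+\delta_3$, $\delta_1=\max\{0,\,2\varepsilon+\bar\psi^*(\delta,\delta_3)-\underline\psi^*(\delta,\delta_3)\}$ and $\hat f(x)=\tilde f(x)-\varepsilon+\underline\psi^*(\delta,\delta_3)$.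 Then $f$ is convex on $\mathrm{dom} f$ and $(\hat f,g,H)$ is a $(\delta_0,\delta_1)$-global inexact oracle of $f$. Moreover, at every $x\in\mathrm{dom}f$ the function $f$ is twice continuously differentiable and $$\|g(x)-\nabla f(x)\|_{H(x)^{-1}}\le\delta,\qquad(1-\delta_3)^2\nabla^2f(x)\preceq H(x)\preceq(1+\delta_3)^2\nabla^2f(x).$$ (b) (For arbitrary $A$.) Let $\delta\ge0$, $x\in\mathrm{dom}f$ and $\tilde u\in\mathrm{dom}\,\varphi$. If $\|\nabla\varphi(\tilde u)-A^\top x\|_{[\nabla^2\varphi(\tilde u)]^{-1}}\le\frac{\delta}{1+\delta}$, then $\tilde u$ is a $\delta$-solution at $x$. -/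

import Mathlib

open scoped Matrix

noncomputable section

namespace SCOracle

/-! Vectors of `ℝᵈ` are functions `Fin d → ℝ`; the inner product is the dot product `⬝ᵥ`, and all
norms are the explicit quadratic-form norms below (the sup norm of `Fin d → ℝ` is used only for its
topology and differential calculus, which do not depend on the choice of a norm). -/

/-- `ω(τ) = τ - ln(1 + τ)`, used for `τ ≥ 0`. -/
def omega (τ : ℝ) : ℝ := τ - Real.log (1 + τ)

/-- `ω_*(τ) = -τ - ln(1 - τ)`, used for `0 ≤ τ < 1`. -/
def omegaStar (τ : ℝ) : ℝ := -τ - Real.log (1 - τ)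

/-- The gradient: the vector of partial derivatives. -/
def grad {d : ℕ} (f : (Fin d → ℝ) → ℝ) (x : Fin d → ℝ) : Fin d → ℝ :=
  fun i => fderiv ℝ f x (Pi.single i 1)

/-- The Hessian: the matrix of second partial derivatives. -/
def hess {d : ℕ} (f : (Fin d → ℝ) → ℝ) (x : Fin d → ℝ) : Matrix (Fin d) (Fin d) ℝ :=
  Matrix.of fun i j => fderiv ℝ (fderiv ℝ f) x (Pi.single i 1) (Pi.single j 1)

/-- `(vᵀ H v)^{1/2}`. -/
def wnorm {d : ℕ} (H : Matrix (Fin d) (Fin d) ℝ) (v : Fin d → ℝ) : ℝ :=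
  Real.sqrt (v ⬝ᵥ (H *ᵥ v))

/-- The dual norm `(vᵀ H⁻¹ v)^{1/2}`. -/
def wnormDual {d : ℕ} (H : Matrix (Fin d) (Fin d) ℝ) (v : Fin d → ℝ) : ℝ :=
  wnorm H⁻¹ v

/-- A univariate convex `C³` function on an open domain `S` with `|h'''| ≤ M (h'')^{3/2}` on `S`. -/
structure IsUnivariateSelfConcordant (M : ℝ) (h : ℝ → ℝ) (S : Set ℝ) : Prop where
  isOpen : IsOpen S
  convexOn : ConvexOn ℝ S h
  contDiffOn : ContDiffOn ℝ 3 h S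
  bound : ∀ τ ∈ S, |iteratedDeriv 3 h τ| ≤ M * (iteratedDeriv 2 h τ) ^ (3 / 2 : ℝ)

/-- A proper closed convex function `φ : ℝⁿ → ℝ ∪ {+∞}` with open domain `D` (only the values on `D`
matter; the function is `+∞` outside) that is three times continuously differentiable on `D`, is
standard self-concordant (`M = 2` along every line), and has a positive definite Hessian on `D`. -/
structure IsStandardSelfConcordant {n : ℕ} (φ : (Fin n → ℝ) → ℝ) (D : Set (Fin n → ℝ)) : Prop where
  nonempty : D.Nonempty
  isOpen : IsOpen D
  convexOn : ConvexOn ℝ D φ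
  closed_epigraph : IsClosed {q : (Fin n → ℝ) × ℝ | q.1 ∈ D ∧ φ q.1 ≤ q.2}
  contDiffOn : ContDiffOn ℝ 3 φ D
  along_lines : ∀ u ∈ D, ∀ v : Fin n → ℝ,
    IsUnivariateSelfConcordant 2 (fun τ : ℝ => φ (u + τ • v)) {τ : ℝ | u + τ • v ∈ D}
  hess_posDef : ∀ u ∈ D, (hess φ u).PosDef

/-- A `(δ₀, δ₁)`-global inexact oracle `(ft, g, H)` of the convex function `f` with domain `X`. -/
structure IsGlobalInexactOracle {p : ℕ} (f : (Fin p → ℝ) → ℝ) (X : Set (Fin p → ℝ))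
    (ft : (Fin p → ℝ) → ℝ) (g : (Fin p → ℝ) → Fin p → ℝ)
    (H : (Fin p → ℝ) → Matrix (Fin p) (Fin p) ℝ) (δ₀ δ₁ : ℝ) : Prop where
  convexOn : ConvexOn ℝ X f
  acc₀ : 0 ≤ δ₀ ∧ δ₀ ≤ 1
  acc₁ : 0 ≤ δ₁
  oracle : ∀ x ∈ X, (H x).PosDef ∧
    ∀ y : Fin p → ℝ, wnorm (H x) (y - x) < 1 / (1 + δ₀) →
      y ∈ X ∧
      omega ((1 - δ₀) * wnorm (H x) (y - x)) ≤ f y - ft x - g x ⬝ᵥ (y - x) ∧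
      f y - ft x - g x ⬝ᵥ (y - x) ≤ omegaStar ((1 + δ₀) * wnorm (H x) (y - x)) + δ₁

section MaxFunction

variable {n p : ℕ} (φ : (Fin n → ℝ) → ℝ) (D : Set (Fin n → ℝ)) (A : Matrix (Fin p) (Fin n) ℝ)

/-- `f(x) = max_{u ∈ D} {⟨u, Aᵀx⟩ - φ(u)}`, a genuine finite supremum for `x` in `maxDom φ D A`. -/
def maxFun (x : Fin p → ℝ) : ℝ :=
  sSup ((fun u => u ⬝ᵥ (Aᵀ *ᵥ x) - φ u) '' D)

/-- `dom f`: the `x` for which `φ(u) - ⟨u, Aᵀx⟩` is bounded below on `D`. -/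
def maxDom : Set (Fin p → ℝ) :=
  {x | BddBelow ((fun u => φ u - u ⬝ᵥ (Aᵀ *ᵥ x)) '' D)}

/-- `us` is a solution `u*(x)` of `min_{u ∈ D} {φ(u) - ⟨u, Aᵀx⟩}`. -/
def IsExactSolution (x : Fin p → ℝ) (us : Fin n → ℝ) : Prop :=
  us ∈ D ∧ ∀ u ∈ D, φ us - us ⬝ᵥ (Aᵀ *ᵥ x) ≤ φ u - u ⬝ᵥ (Aᵀ *ᵥ x)

/-- `ut` is a `δ`-solution: `u*(x)` exists, and `‖ut - u*(x)‖_{ut} ≤ δ` in the local norm of `φ`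
(`u*(x)` is unique for the strictly convex `φ` considered here). -/
def IsDeltaSolution (x : Fin p → ℝ) (δ : ℝ) (ut : Fin n → ℝ) : Prop :=
  ut ∈ D ∧ ∃ us, IsExactSolution φ D A x us ∧ wnorm (hess φ ut) (ut - us) ≤ δ

/-- `f̃(x) = ⟨ũ(x), Aᵀx⟩ - φ(ũ(x))`. -/
def approxVal (ut : (Fin p → ℝ) → Fin n → ℝ) (x : Fin p → ℝ) : ℝ :=
  ut x ⬝ᵥ (Aᵀ *ᵥ x) - φ (ut x)

/-- `g(x) = A ũ(x)`. -/
def approxGrad (ut : (Fin p → ℝ) → Fin n → ℝ) (x : Fin p → ℝ) : Fin p → ℝ :=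
  A *ᵥ ut x

/-- `H(x) = A [∇²φ(ũ(x))]⁻¹ Aᵀ`. -/
def approxHess (ut : (Fin p → ℝ) → Fin n → ℝ) (x : Fin p → ℝ) : Matrix (Fin p) (Fin p) ℝ :=
  A * (hess φ (ut x))⁻¹ * Aᵀ

end MaxFunction

def cLower (δ₂ δ₃ : ℝ) : ℝ :=
  Real.sqrt ((1 - δ₂ - δ₃) ^ 2 + (1 - δ₃) * (1 - 2 * δ₂ - δ₃))

def cUpper (δ₂ δ₃ : ℝ) : ℝ :=
  Real.sqrt (9 * (1 + δ₂ + δ₃) ^ 2 - 3 * (1 + δ₃) * (1 + 2 * δ₂ + δ₃))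

/-- The minimum over `t ≥ 0` of `-δ₂ t + ω((1-δ₃) t) - ω((1-2δ₂-δ₃) t)`, in closed form. -/
def psiLower (δ₂ δ₃ : ℝ) : ℝ :=
  δ₂ / ((1 - δ₂ - δ₃) + cLower δ₂ δ₃)
    - Real.log (1 + 2 * δ₂ / ((2 - 3 * δ₂ - 2 * δ₃) + cLower δ₂ δ₃))

/-- The maximum over `0 ≤ t < 1/(1+2δ₂+δ₃)` of `δ₂ t + ω_*((1+δ₃) t) - ω_*((1+2δ₂+δ₃) t)`,
in closed form. -/
def psiUpper (δ₂ δ₃ : ℝ) : ℝ :=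
  3 * δ₂ / (3 * (1 + δ₂ + δ₃) + cUpper δ₂ δ₃)
    - Real.log (1 + 2 * δ₂ / ((2 + δ₂ + 2 * δ₃) + cUpper δ₂ δ₃))

/-- `δ₀ = 2δ₂ + δ₃`. -/
def acc0 (δ₂ δ₃ : ℝ) : ℝ := 2 * δ₂ + δ₃

/-- `δ₁ = max{0, 2ε + ψ̄(δ₂,δ₃) - ψ̲(δ₂,δ₃)}`. -/
def acc1 (ε δ₂ δ₃ : ℝ) : ℝ := max 0 (2 * ε + psiUpper δ₂ δ₃ - psiLower δ₂ δ₃)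

end SCOracle

end

/-! Self-concordance makes `1 / √h''` a 1-Lipschitz function along every line. Integrating once,
twice and three times bounds the Hessian, the gradient and the values of `φ` in the local norm,
the last by `ω` and `ω_*`; the Hessian comparison in directions transversal to the line rests on
Banach's theorem that a symmetric trilinear form is bounded by its diagonal. When the dual local
norm of `∇φ(u) - Aᵀx` is below `1`, the lower bound makes the sublevel set compact, so `u*(x)`
exists, and the gradient bound measures its distance to `u`.

The function `f` is the convex conjugate of `φ` composed with `Aᵀ`. By the inverse function
theorem `u*` is smooth, so `∇f = A u*` and `∇²f = A [∇²φ(u*)]⁻¹ Aᵀ`, and Young's inequality for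
the pair `ω`, `ω_*` turns the bounds on `φ` into bounds on `f` in the norm of `∇²f`. Replacing
`u*` by a `δ`-solution changes the linear term by at most `δ r`, the norm by a factor between
`1 - δ₃` and `1 + δ₃`, and the value by at most `ω_*(δ₃)`; the worst case over `r` of what is
lost to the factors `1 ∓ δ₀` is `ψ̲*` from below and `ψ̄*` from above. -/

namespace SCOracle

open scoped Topology

section Omega

theorem hasDerivAt_omega {r : ℝ} (hr : -1 < r) : HasDerivAt omega (r / (1 + r)) r := by
  have hpos : 1 + r ≠ 0 := by linarith
  have h := (hasDerivAt_id r).sub (((hasDerivAt_id r).const_add 1).log hpos)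
  exact h.congr_deriv (by simp only [id]; field_simp; ring)

theorem hasDerivAt_omegaStar {r : ℝ} (hr : r < 1) : HasDerivAt omegaStar (r / (1 - r)) r := by
  have hpos : 1 - r ≠ 0 := by linarith
  have h := (hasDerivAt_id r).neg.sub (((hasDerivAt_id r).const_sub 1).log hpos)
  exact h.congr_deriv (by simp only [id]; field_simp; ring)

@[simp] theorem omega_zero : omega 0 = 0 := by simp [omega]

@[simp] theorem omegaStar_zero : omegaStar 0 = 0 := by simp [omegaStar]

theorem monotoneOn_omega : MonotoneOn omega (Set.Ici 0) := by
  refine monotoneOn_of_deriv_nonneg (convex_Ici 0)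
    (fun r hr => (hasDerivAt_omega ?_).continuousAt.continuousWithinAt)
    (fun r hr => (hasDerivAt_omega ?_).differentiableAt.differentiableWithinAt) fun r hr => ?_
  · linarith [Set.mem_Ici.1 hr]
  · rw [interior_Ici] at hr
    linarith [Set.mem_Ioi.1 hr]
  · rw [interior_Ici] at hr
    have hr0 : 0 < r := hr
    rw [(hasDerivAt_omega (by linarith)).deriv]
    positivity

theorem monotoneOn_omegaStar : MonotoneOn omegaStar (Set.Ico 0 1) := by
  refine monotoneOn_of_deriv_nonneg (convex_Ico 0 1)
    (fun r hr => (hasDerivAt_omegaStar hr.2).continuousAt.continuousWithinAt)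
    (fun r hr => (hasDerivAt_omegaStar ?_).differentiableAt.differentiableWithinAt) fun r hr => ?_
  · rw [interior_Ico] at hr
    exact hr.2
  · rw [interior_Ico] at hr
    rw [(hasDerivAt_omegaStar hr.2).deriv]
    exact div_nonneg hr.1.le (sub_nonneg.2 hr.2.le)

theorem omega_nonneg {r : ℝ} (hr : 0 ≤ r) : 0 ≤ omega r :=
  omega_zero ▸ monotoneOn_omega Set.self_mem_Ici hr hr

theorem mul_sub_omega_le_omegaStar {r s : ℝ} (hr : r < 1) (hs : -1 < s) :
    s * r - omega s ≤ omegaStar r := by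
  have hs' : 0 < 1 + s := by linarith
  have hr' : 0 < 1 - r := by linarith
  have h := Real.log_le_sub_one_of_pos (mul_pos hs' hr')
  rw [Real.log_mul hs'.ne' hr'.ne'] at h
  rw [omega, omegaStar]
  linarith

theorem mul_sub_omegaStar_eq_omega {r : ℝ} (hr : -1 < r) :
    r / (1 + r) * r - omegaStar (r / (1 + r)) = omega r := by
  have hne : 1 + r ≠ 0 := by linarith
  have hinv : 1 - r / (1 + r) = (1 + r)⁻¹ := by field_simp; ring
  rw [omegaStar, omega, hinv, Real.log_inv]
  field_simp
  ring

end Omega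

section Psi

/-- Both `t ↦ -δ₂ t + ω((1 - δ₃) t) - ω((1 - 2δ₂ - δ₃) t)` and its upper counterpart are, up to sign
and scale, of the form `log (1 + a t) - log (1 + b t) - c t`; `t₀` is the critical point. -/
theorem log_sub_log_sub_mul_le {a b c t t₀ : ℝ} (ha : 0 < 1 + a * t) (hb : 0 < 1 + b * t)
    (ha₀ : 0 < 1 + a * t₀) (hb₀ : 0 < 1 + b * t₀) (hbc : 0 ≤ b * c)
    (hcrit : a - b = c * ((1 + a * t₀) * (1 + b * t₀))) :
    Real.log (1 + a * t) - Real.log (1 + b * t) - c * t ≤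
      Real.log (1 + a * t₀) - Real.log (1 + b * t₀) - c * t₀ := by
  have hlog := Real.log_le_sub_one_of_pos (div_pos (mul_pos ha hb₀) (mul_pos hb ha₀))
  rw [Real.log_div (mul_pos ha hb₀).ne' (mul_pos hb ha₀).ne', Real.log_mul ha.ne' hb₀.ne',
    Real.log_mul hb.ne' ha₀.ne'] at hlog
  have hratio : (1 + a * t) * (1 + b * t₀) / ((1 + b * t) * (1 + a * t₀)) - 1 =
      c * (t - t₀) * (1 + b * t₀) / (1 + b * t) := by
    rw [div_sub_one (mul_pos hb ha₀).ne', div_eq_div_iff (mul_pos hb ha₀).ne' hb.ne']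
    linear_combination (t - t₀) * (1 + b * t) * hcrit
  have hgap : c * (t - t₀) - c * (t - t₀) * (1 + b * t₀) / (1 + b * t) =
      b * c * (t - t₀) ^ 2 / (1 + b * t) := by
    rw [sub_eq_iff_eq_add, ← add_div, eq_div_iff hb.ne']
    ring
  have hgap_nonneg : 0 ≤ b * c * (t - t₀) ^ 2 / (1 + b * t) := by positivity
  linarith

/-- The function of `t` whose minimum over `t ≥ 0` is `psiLower`. -/
noncomputable def lowerGap (δ₂ δ₃ t : ℝ) : ℝ :=
  -δ₂ * t + omega ((1 - δ₃) * t) - omega ((1 - acc0 δ₂ δ₃) * t)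

/-- The function of `t` whose maximum over `0 ≤ t < 1 / (1 + acc0 δ₂ δ₃)` is `psiUpper`. -/
noncomputable def upperGap (δ₂ δ₃ t : ℝ) : ℝ :=
  δ₂ * t + omegaStar ((1 + δ₃) * t) - omegaStar ((1 + acc0 δ₂ δ₃) * t)

/-- The minimizer of `lowerGap`. -/
noncomputable def lowerGapArg (δ₂ δ₃ : ℝ) : ℝ := ((1 - δ₂ - δ₃) + cLower δ₂ δ₃)⁻¹

/-- The maximizer of `upperGap`. -/
noncomputable def upperGapArg (δ₂ δ₃ : ℝ) : ℝ := (3 * (1 + δ₂ + δ₃) + cUpper δ₂ δ₃)⁻¹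

variable {δ₂ δ₃ : ℝ}

theorem lowerGap_eq_sub_log (δ₂ δ₃ t : ℝ) :
    lowerGap δ₂ δ₃ t =
      δ₂ * t - (Real.log (1 + (1 - δ₃) * t) - Real.log (1 + (1 - acc0 δ₂ δ₃) * t)) := by
  rw [lowerGap, omega, omega, acc0]
  ring

theorem upperGap_eq_sub_log (δ₂ δ₃ t : ℝ) :
    upperGap δ₂ δ₃ t =
      3 * δ₂ * t - (Real.log (1 + -(1 + δ₃) * t) - Real.log (1 + -(1 + acc0 δ₂ δ₃) * t)) := by
  rw [upperGap, omegaStar, omegaStar, acc0, neg_mul, neg_mul, ← sub_eq_add_neg, ← sub_eq_add_neg]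
  ring

theorem lowerGapArg_spec (h₃ : δ₃ < 1) (h : acc0 δ₂ δ₃ ≤ 1) :
    0 < lowerGapArg δ₂ δ₃ ∧
      (1 + (1 - δ₃) * lowerGapArg δ₂ δ₃) * (1 + (1 - acc0 δ₂ δ₃) * lowerGapArg δ₂ δ₃) = 2 := by
  have hacc : 0 ≤ 1 - 2 * δ₂ - δ₃ := by rw [acc0] at h; linarith
  have hsq : cLower δ₂ δ₃ ^ 2 = (1 - δ₂ - δ₃) ^ 2 + (1 - δ₃) * (1 - 2 * δ₂ - δ₃) :=
    Real.sq_sqrt (add_nonneg (sq_nonneg _) (mul_nonneg (by linarith) hacc))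
  have hs : 0 < (1 - δ₂ - δ₃) + cLower δ₂ δ₃ := by
    have := Real.sqrt_nonneg ((1 - δ₂ - δ₃) ^ 2 + (1 - δ₃) * (1 - 2 * δ₂ - δ₃))
    rw [cLower]
    linarith
  refine ⟨inv_pos.2 hs, ?_⟩
  rw [lowerGapArg, acc0]
  field_simp
  linear_combination -hsq

theorem upperGapArg_spec (h₂ : 0 ≤ δ₂) (h₃ : 0 ≤ δ₃) :
    0 < upperGapArg δ₂ δ₃ ∧ 0 < 1 - (1 + acc0 δ₂ δ₃) * upperGapArg δ₂ δ₃ ∧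
      3 * ((1 - (1 + δ₃) * upperGapArg δ₂ δ₃) *
        (1 - (1 + acc0 δ₂ δ₃) * upperGapArg δ₂ δ₃)) = 2 := by
  have hsq : cUpper δ₂ δ₃ ^ 2 =
      9 * (1 + δ₂ + δ₃) ^ 2 - 3 * (1 + δ₃) * (1 + 2 * δ₂ + δ₃) :=
    Real.sq_sqrt (by nlinarith [mul_nonneg h₂ h₃, sq_nonneg (1 + δ₂ + δ₃), sq_nonneg δ₂])
  have hc : 0 ≤ cUpper δ₂ δ₃ := Real.sqrt_nonneg _
  have hs : 0 < 3 * (1 + δ₂ + δ₃) + cUpper δ₂ δ₃ := by positivity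
  refine ⟨inv_pos.2 hs, ?_, ?_⟩ <;> rw [upperGapArg, acc0]
  · rw [sub_pos, ← div_eq_mul_inv, div_lt_one hs]
    linarith
  · field_simp
    linear_combination hsq

theorem psiLower_eq_lowerGap (h₃ : δ₃ < 1) (h : acc0 δ₂ δ₃ ≤ 1) :
    psiLower δ₂ δ₃ = lowerGap δ₂ δ₃ (lowerGapArg δ₂ δ₃) := by
  obtain ⟨ht, -⟩ := lowerGapArg_spec h₃ h
  have ha : 0 < 1 + (1 - δ₃) * lowerGapArg δ₂ δ₃ := by
    have := sub_pos.2 h₃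
    positivity
  have hb : 0 < 1 + (1 - acc0 δ₂ δ₃) * lowerGapArg δ₂ δ₃ := by
    have := sub_nonneg.2 h
    positivity
  have hratio : 1 + 2 * δ₂ / ((2 - 3 * δ₂ - 2 * δ₃) + cLower δ₂ δ₃) =
      (1 + (1 - δ₃) * lowerGapArg δ₂ δ₃) / (1 + (1 - acc0 δ₂ δ₃) * lowerGapArg δ₂ δ₃) := by
    have hs : (1 - δ₂ - δ₃) + cLower δ₂ δ₃ ≠ 0 := (inv_pos.1 ht).ne'
    have hden : (2 - 3 * δ₂ - 2 * δ₃) + cLower δ₂ δ₃ = ((1 - δ₂ - δ₃) + cLower δ₂ δ₃) *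
        (1 + (1 - acc0 δ₂ δ₃) * lowerGapArg δ₂ δ₃) := by
      rw [lowerGapArg, acc0]
      field_simp
      ring
    rw [hden, eq_div_iff hb.ne', add_mul, div_mul_eq_mul_div, mul_div_mul_right _ _ hb.ne',
      lowerGapArg, acc0]
    field_simp
    ring
  rw [lowerGap_eq_sub_log, ← Real.log_div ha.ne' hb.ne', psiLower, hratio, lowerGapArg,
    div_eq_mul_inv]

theorem psiUpper_eq_upperGap (h₂ : 0 ≤ δ₂) (h₃ : 0 ≤ δ₃) :
    psiUpper δ₂ δ₃ = upperGap δ₂ δ₃ (upperGapArg δ₂ δ₃) := by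
  obtain ⟨ht, hb, hcrit⟩ := upperGapArg_spec h₂ h₃
  have ha : 0 < 1 + -(1 + δ₃) * upperGapArg δ₂ δ₃ := by nlinarith
  replace hb : 0 < 1 + -(1 + acc0 δ₂ δ₃) * upperGapArg δ₂ δ₃ := by rwa [neg_mul, ← sub_eq_add_neg]
  have hratio : 1 + 2 * δ₂ / ((2 + δ₂ + 2 * δ₃) + cUpper δ₂ δ₃) =
      (1 + -(1 + δ₃) * upperGapArg δ₂ δ₃) / (1 + -(1 + acc0 δ₂ δ₃) * upperGapArg δ₂ δ₃) := by
    have hs : 3 * (1 + δ₂ + δ₃) + cUpper δ₂ δ₃ ≠ 0 := (inv_pos.1 ht).ne'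
    have hden : (2 + δ₂ + 2 * δ₃) + cUpper δ₂ δ₃ = (3 * (1 + δ₂ + δ₃) + cUpper δ₂ δ₃) *
        (1 + -(1 + acc0 δ₂ δ₃) * upperGapArg δ₂ δ₃) := by
      rw [upperGapArg, acc0]
      field_simp
      ring
    rw [hden, eq_div_iff hb.ne', add_mul, div_mul_eq_mul_div, mul_div_mul_right _ _ hb.ne',
      upperGapArg, acc0]
    field_simp
    ring
  rw [upperGap_eq_sub_log, ← Real.log_div ha.ne' hb.ne', psiUpper, hratio, upperGapArg,
    div_eq_mul_inv]

theorem psiLower_le_lowerGap {t : ℝ} (h₂ : 0 ≤ δ₂) (h₃ : δ₃ < 1) (h : acc0 δ₂ δ₃ ≤ 1)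
    (ht : 0 ≤ t) : psiLower δ₂ δ₃ ≤ lowerGap δ₂ δ₃ t := by
  obtain ⟨ht₀, hcrit⟩ := lowerGapArg_spec h₃ h
  have : 0 ≤ 1 - δ₃ := by linarith
  have : 0 ≤ 1 - acc0 δ₂ δ₃ := by linarith
  have hmax := log_sub_log_sub_mul_le (a := 1 - δ₃) (b := 1 - acc0 δ₂ δ₃) (c := δ₂) (t := t)
    (t₀ := lowerGapArg δ₂ δ₃) (by positivity) (by positivity) (by positivity) (by positivity)
    (by positivity) (by rw [hcrit, acc0]; ring)
  rw [psiLower_eq_lowerGap h₃ h, lowerGap_eq_sub_log, lowerGap_eq_sub_log]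
  linarith

theorem upperGap_le_psiUpper {t : ℝ} (h₂ : 0 ≤ δ₂) (h₃ : 0 ≤ δ₃) (ht : 0 ≤ t)
    (ht₁ : (1 + acc0 δ₂ δ₃) * t < 1) : upperGap δ₂ δ₃ t ≤ psiUpper δ₂ δ₃ := by
  obtain ⟨ht₀, hb₀, hcrit⟩ := upperGapArg_spec h₂ h₃
  have hle : 1 + δ₃ ≤ 1 + acc0 δ₂ δ₃ := by rw [acc0]; linarith
  have hmax := log_sub_log_sub_mul_le (a := -(1 + acc0 δ₂ δ₃)) (b := -(1 + δ₃)) (c := -(3 * δ₂))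
    (t := t) (t₀ := upperGapArg δ₂ δ₃) (by linarith) (by nlinarith) (by linarith) (by nlinarith)
    (by rw [neg_mul_neg]; positivity) (by unfold acc0 at hcrit ⊢; linear_combination δ₂ * hcrit)
  rw [psiUpper_eq_upperGap h₂ h₃, upperGap_eq_sub_log, upperGap_eq_sub_log]
  linarith

end Psi

section Trilinear

open scoped RealInnerProductSpace

/-- A binary cubic form, normalized so that the coefficients are the values of its polarization on
the standard basis. -/
def binaryCubic (A B C D x y : ℝ) : ℝ :=
  A * x ^ 3 + 3 * B * x ^ 2 * y + 3 * C * x * y ^ 2 + D * y ^ 3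

/-- The squared, normalized Dirichlet kernel `(sin 3t / (3 sin t))²`, as a function of
`x = cos t`. -/
noncomputable def fejerWeight (x : ℝ) : ℝ := 16 / 9 * (x ^ 2 - 1 / 4) ^ 2

/-- With `(x, y) = (cos t, sin t)`, the right-hand side is `A cos 3t + B sin 3t`; the nodes are
`t` and `t ± 2π/3`. -/
theorem exists_fejer_quadrature {x y : ℝ} (hxy : x ^ 2 + y ^ 2 = 1) :
    ∃ u v w z : ℝ, u ^ 2 + v ^ 2 = 1 ∧ w ^ 2 + z ^ 2 = 1 ∧
      fejerWeight x + fejerWeight u + fejerWeight w = 1 ∧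
      ∀ A B C D : ℝ,
        fejerWeight x * binaryCubic A B C D x y + fejerWeight u * binaryCubic A B C D u v +
          fejerWeight w * binaryCubic A B C D w z =
        A * (4 * x ^ 3 - 3 * x) + B * (3 * y - 4 * y ^ 3) := by
  obtain ⟨q, hq⟩ : ∃ q : ℝ, q ^ 2 = 3 := ⟨√3, Real.sq_sqrt (by norm_num)⟩
  obtain ⟨u, hu⟩ : ∃ u, u = -x / 2 - q / 2 * y := ⟨_, rfl⟩
  obtain ⟨v, hv⟩ : ∃ v, v = -y / 2 + q / 2 * x := ⟨_, rfl⟩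
  obtain ⟨w, hw⟩ : ∃ w, w = -x / 2 + q / 2 * y := ⟨_, rfl⟩
  obtain ⟨z, hz⟩ : ∃ z, z = -y / 2 - q / 2 * x := ⟨_, rfl⟩
  refine ⟨u, v, w, z, by grind, by grind, by
    simp only [fejerWeight]; grind, fun A B C D => ?_⟩
  obtain ⟨hA, hB, hC, hD⟩ :
      fejerWeight x * x ^ 3 + fejerWeight u * u ^ 3 + fejerWeight w * w ^ 3 = 4 * x ^ 3 - 3 * x ∧
      fejerWeight x * (x ^ 2 * y) + fejerWeight u * (u ^ 2 * v) + fejerWeight w * (w ^ 2 * z) =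
        (3 * y - 4 * y ^ 3) / 3 ∧
      fejerWeight x * (x * y ^ 2) + fejerWeight u * (u * v ^ 2) + fejerWeight w * (w * z ^ 2) = 0 ∧
      fejerWeight x * y ^ 3 + fejerWeight u * v ^ 3 + fejerWeight w * z ^ 3 = 0 := by
    simp only [fejerWeight]
    refine ⟨?_, ?_, ?_, ?_⟩ <;> grind
  simp only [binaryCubic]
  linear_combination A * hA + 3 * B * hB + 3 * C * hC + D * hD

theorem exists_eq_cos_sin_three_mul (a b : ℝ) :
    ∃ t, a = √(a ^ 2 + b ^ 2) * Real.cos (3 * t) ∧ b = √(a ^ 2 + b ^ 2) * Real.sin (3 * t) := by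
  have hnorm : ‖(⟨a, b⟩ : ℂ)‖ = √(a ^ 2 + b ^ 2) := by
    rw [Complex.norm_def, Complex.normSq_mk, ← sq, ← sq]
  refine ⟨Complex.arg ⟨a, b⟩ / 3, ?_, ?_⟩ <;> rw [mul_div_cancel₀ _ three_ne_zero, ← hnorm]
  · rw [Complex.norm_mul_cos_arg]
  · rw [Complex.norm_mul_sin_arg]

/-- Szegő's form of Bernstein's inequality for trigonometric polynomials, in degree three. -/
theorem add_le_mul_sqrt_of_binaryCubic_le {A B C D M : ℝ}
    (h : ∀ x y : ℝ, x ^ 2 + y ^ 2 = 1 → binaryCubic A B C D x y ≤ M) (a b : ℝ) :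
    A * a + B * b ≤ M * √(a ^ 2 + b ^ 2) := by
  obtain ⟨t, ha, hb⟩ := exists_eq_cos_sin_three_mul a b
  obtain ⟨u, v, w, z, huv, hwz, hsum, hquad⟩ :=
    exists_fejer_quadrature (Real.cos_sq_add_sin_sq t)
  have hnode (x y : ℝ) (hxy : x ^ 2 + y ^ 2 = 1) :
      fejerWeight x * binaryCubic A B C D x y ≤ fejerWeight x * M :=
    mul_le_mul_of_nonneg_left (h x y hxy) (by unfold fejerWeight; positivity)
  have hunit : A * Real.cos (3 * t) + B * Real.sin (3 * t) ≤ M := by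
    rw [Real.cos_three_mul, Real.sin_three_mul, ← hquad A B C D]
    calc _ ≤ fejerWeight (Real.cos t) * M + fejerWeight u * M + fejerWeight w * M :=
          add_le_add_three (hnode _ _ (Real.cos_sq_add_sin_sq t)) (hnode u v huv) (hnode w z hwz)
      _ = M := by rw [← add_mul, ← add_mul, hsum, one_mul]
  calc A * a + B * b = √(a ^ 2 + b ^ 2) * (A * Real.cos (3 * t) + B * Real.sin (3 * t)) := by
        linear_combination A * ha + B * hb
    _ ≤ √(a ^ 2 + b ^ 2) * M := mul_le_mul_of_nonneg_left hunit (Real.sqrt_nonneg _)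
    _ = M * √(a ^ 2 + b ^ 2) := mul_comm _ _

section InnerProductSpace

variable {E : Type*} [NormedAddCommGroup E] [InnerProductSpace ℝ E]
  {T : E →ₗ[ℝ] E →ₗ[ℝ] E →ₗ[ℝ] ℝ} {M : ℝ}

theorem trilinear_add_le_of_orthogonal (hswap₁ : ∀ a b c, T a b c = T b a c)
    (hswap₂ : ∀ a b c, T a b c = T a c b) (hT : ∀ a, T a a a ≤ M * ‖a‖ ^ 3) {e c : E}
    (he : ‖e‖ = 1) (hc : ‖c‖ ≤ 1) (hec : ⟪e, c⟫ = 0) (α β : ℝ) :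
    T e e e * α + T c e e * β ≤ M * √(α ^ 2 + β ^ 2) := by
  have hM : 0 ≤ M := by
    have hpos := hT e
    have hneg := hT (-e)
    simp only [map_neg, LinearMap.neg_apply, norm_neg, he] at hpos hneg
    linarith
  refine add_le_mul_sqrt_of_binaryCubic_le (C := T c c e) (D := T c c c) (fun x y hxy => ?_) α β
  have hnorm : ‖x • e + y • c‖ ≤ 1 := by
    refine (sq_le_one_iff₀ (norm_nonneg _)).1 ?_
    rw [norm_add_sq_real, real_inner_smul_left, real_inner_smul_right, hec, norm_smul, norm_smul,
      he, mul_pow, mul_pow, Real.norm_eq_abs, Real.norm_eq_abs, sq_abs, sq_abs]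
    nlinarith [sq_nonneg y, pow_le_one₀ (n := 2) (norm_nonneg c) hc]
  calc binaryCubic (T e e e) (T c e e) (T c c e) (T c c c) x y
      = T (x • e + y • c) (x • e + y • c) (x • e + y • c) := by
        simp only [binaryCubic, map_add, map_smul, LinearMap.add_apply, LinearMap.smul_apply,
          smul_eq_mul]
        rw [hswap₁ e c e, hswap₁ e c c, hswap₂ e e c, hswap₁ e c e, hswap₂ c e c]
        ring
    _ ≤ M * ‖x • e + y • c‖ ^ 3 := hT _
    _ ≤ M := mul_le_of_le_one_right hM (pow_le_one₀ (norm_nonneg _) hnorm)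

theorem exists_eq_smul_add_smul_orthogonal {e : E} (he : ‖e‖ = 1) (a : E) :
    ∃ (α β : ℝ) (c : E), a = α • e + β • c ∧ ‖c‖ ≤ 1 ∧ ⟪e, c⟫ = 0 ∧ √(α ^ 2 + β ^ 2) = ‖a‖ := by
  let d : E := a - ⟪e, a⟫ • e
  have had : a = ⟪e, a⟫ • e + d := (add_sub_cancel _ a).symm
  have hed : ⟪e, d⟫ = 0 := by
    rw [inner_sub_right, real_inner_smul_right, real_inner_self_eq_norm_sq, he]
    ring
  have hdc : ‖d‖ • ‖d‖⁻¹ • d = d := by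
    obtain hd | hd := eq_or_ne d 0
    · simp [hd]
    · exact smul_inv_smul₀ (norm_ne_zero_iff.2 hd) d
  have hnorm : ‖a‖ * ‖a‖ = ⟪e, a⟫ ^ 2 + ‖d‖ ^ 2 := by
    conv_lhs => rw [had]
    rw [norm_add_mul_self_real, real_inner_smul_left, hed, norm_smul, he, Real.norm_eq_abs,
      mul_one, abs_mul_abs_self]
    ring
  refine ⟨⟪e, a⟫, ‖d‖, ‖d‖⁻¹ • d, by rwa [hdc], ?_, by rw [real_inner_smul_right, hed, mul_zero],
    by rw [← hnorm, Real.sqrt_mul_self (norm_nonneg a)]⟩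
  rw [norm_smul, norm_inv, norm_norm]
  exact inv_mul_le_one

/-- A case of Banach's theorem that the norm of a symmetric multilinear form on a Euclidean space is
attained on the diagonal. -/
theorem trilinear_apply_le_of_diagonal_le (hswap₁ : ∀ a b c, T a b c = T b a c)
    (hswap₂ : ∀ a b c, T a b c = T a c b) (hT : ∀ a, T a a a ≤ M * ‖a‖ ^ 3) (a b : E) :
    T a b b ≤ M * ‖a‖ * ‖b‖ ^ 2 := by
  obtain rfl | hb := eq_or_ne b 0
  · simp
  obtain ⟨e, he, hbe⟩ : ∃ e : E, ‖e‖ = 1 ∧ b = ‖b‖ • e :=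
    ⟨‖b‖⁻¹ • b, norm_smul_inv_norm hb, (smul_inv_smul₀ (norm_ne_zero_iff.2 hb) b).symm⟩
  obtain ⟨α, β, c, ha, hc, hec, hnorm⟩ := exists_eq_smul_add_smul_orthogonal he a
  have hunit : T a e e ≤ M * ‖a‖ := calc
    T a e e = T e e e * α + T c e e * β := by
      rw [ha]
      simp only [map_add, map_smul, LinearMap.add_apply, LinearMap.smul_apply, smul_eq_mul]
      ring
    _ ≤ M * ‖a‖ := hnorm ▸ trilinear_add_le_of_orthogonal hswap₁ hswap₂ hT he hc hec α β
  calc T a b b = ‖b‖ ^ 2 * T a e e := by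
        conv_lhs => rw [hbe]
        simp only [map_smul, LinearMap.smul_apply, smul_eq_mul]
        ring
    _ ≤ ‖b‖ ^ 2 * (M * ‖a‖) := mul_le_mul_of_nonneg_left hunit (sq_nonneg _)
    _ = M * ‖a‖ * ‖b‖ ^ 2 := mul_comm _ _

/-- The inner product is given by `B`, so that the ambient space need not carry a norm. -/
theorem trilinear_apply_le_of_posDef {E : Type*} [AddCommGroup E] [Module ℝ E]
    {B : E →ₗ[ℝ] E →ₗ[ℝ] ℝ} {T : E →ₗ[ℝ] E →ₗ[ℝ] E →ₗ[ℝ] ℝ} {M : ℝ}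
    (hsymm : ∀ a b, B a b = B b a) (hpos : ∀ a, a ≠ 0 → 0 < B a a)
    (hswap₁ : ∀ a b c, T a b c = T b a c) (hswap₂ : ∀ a b c, T a b c = T a c b)
    (hT : ∀ a, T a a a ≤ M * √(B a a) ^ 3) (a b : E) :
    T a b b ≤ M * √(B a a) * √(B b b) ^ 2 := by
  let core : InnerProductSpace.Core ℝ E :=
    { inner := fun a b => B a b
      conj_inner_symm := fun a b => hsymm b a
      re_inner_nonneg := fun a => by
        obtain rfl | ha := eq_or_ne a 0
        · simp
        · exact (hpos a ha).le
      add_left := fun a b c => by simp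
      smul_left := fun a b r => by simp
      definite := fun a ha => by_contra fun hne => (hpos a hne).ne' ha }
  let _ : NormedAddCommGroup E := core.toNormedAddCommGroup
  let _ : InnerProductSpace ℝ E := .ofCore core.toCore
  exact trilinear_apply_le_of_diagonal_le hswap₁ hswap₂ hT a b

end InnerProductSpace

end Trilinear

section Scalar

open Set

theorem le_of_hasDerivAt_le {f g f' g' : ℝ → ℝ} {a b : ℝ}
    (hf : ∀ τ ∈ Icc a b, HasDerivAt f (f' τ) τ) (hg : ∀ τ ∈ Icc a b, HasDerivAt g (g' τ) τ)
    (ha : f a ≤ g a) (hle : ∀ τ ∈ Icc a b, f' τ ≤ g' τ) {τ : ℝ} (hτ : τ ∈ Icc a b) :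
    f τ ≤ g τ :=
  image_le_of_deriv_right_le_deriv_boundary
    (fun t ht => (hf t ht).continuousAt.continuousWithinAt)
    (fun t ht => (hf t (Ico_subset_Icc_self ht)).hasDerivWithinAt) ha
    (fun t ht => (hg t ht).continuousAt.continuousWithinAt)
    (fun t ht => (hg t (Ico_subset_Icc_self ht)).hasDerivWithinAt)
    (fun t ht => hle t (Ico_subset_Icc_self ht)) hτ

theorem hasDerivAt_mul_div_one_add (r : ℝ) {τ : ℝ} (hτ : 1 + r * τ ≠ 0) :
    HasDerivAt (fun t => r * (r * t / (1 + r * t))) ((r / (1 + r * τ)) ^ 2) τ := by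
  have hlin : HasDerivAt (fun t => r * t) r τ := by simpa using (hasDerivAt_id τ).const_mul r
  exact ((hlin.div (hlin.const_add 1) hτ).const_mul r).congr_deriv (by field_simp; ring)

theorem hasDerivAt_one_sub_mul_sq (r τ : ℝ) :
    HasDerivAt (fun t => (1 - r * t) ^ 2) (-(2 * r * (1 - r * τ))) τ := by
  have hlin : HasDerivAt (fun t => 1 - r * t) (-r) τ := by
    simpa using ((hasDerivAt_id τ).const_mul r).const_sub 1
  exact (hlin.pow 2).congr_deriv (by push_cast; ring)

/-- The two monotone quantities are `g (1 - r t)²` and `g / (1 - r t)²`. -/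
theorem one_sub_sq_mul_le_of_abs_deriv_le {g g' : ℝ → ℝ} {r : ℝ} (hr₀ : 0 ≤ r) (hr₁ : r < 1)
    (hg : ∀ t ∈ Icc (0 : ℝ) 1, HasDerivAt g (g' t) t)
    (hg' : ∀ t ∈ Icc (0 : ℝ) 1, |g' t| * (1 - r * t) ≤ 2 * r * g t) :
    (1 - r) ^ 2 * g 1 ≤ g 0 ∧ (1 - r) ^ 2 * g 0 ≤ g 1 := by
  have hden (t : ℝ) (ht : t ∈ Icc (0 : ℝ) 1) : 0 < 1 - r * t := by nlinarith [ht.1, ht.2]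
  have hgrow (t : ℝ) (ht : t ∈ Icc (0 : ℝ) 1) :
      |g' t| * (1 - r * t) ^ 2 ≤ 2 * r * (1 - r * t) * g t := by
    linarith [mul_le_mul_of_nonneg_right (hg' t ht) (hden t ht).le]
  have hanti := le_of_hasDerivAt_le (fun t ht => (hg t ht).mul (hasDerivAt_one_sub_mul_sq r t))
    (fun t _ => hasDerivAt_const t (g 0)) (by simp) (fun t ht => by
      linarith [hgrow t ht, mul_le_mul_of_nonneg_right (le_abs_self (g' t))
        (sq_nonneg (1 - r * t))])
    (right_mem_Icc.2 zero_le_one)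
  have hmono := le_of_hasDerivAt_le (fun t _ => hasDerivAt_const t (g 0))
    (fun t ht => (hg t ht).div (hasDerivAt_one_sub_mul_sq r t) (pow_pos (hden t ht) 2).ne')
    (by simp) (fun t ht => div_nonneg (by
      linarith [hgrow t ht, mul_le_mul_of_nonneg_right (neg_abs_le (g' t))
        (sq_nonneg (1 - r * t))]) (sq_nonneg _))
    (right_mem_Icc.2 zero_le_one)
  simp only [Pi.mul_apply, Pi.div_apply, mul_one] at hanti hmono
  rw [le_div_iff₀ (pow_pos (by linarith) 2)] at hmono
  exact ⟨by linarith, by linarith⟩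

section UnitInterval

variable {h h₁ h₂ h₃ : ℝ → ℝ} {τ : ℝ}

theorem hasDerivAt_inv_sqrt (hd₂ : HasDerivAt h₂ (h₃ τ) τ) (hpos : 0 < h₂ τ) :
    HasDerivAt (fun t => (√(h₂ t))⁻¹) (-(h₃ τ / (2 * √(h₂ τ) ^ 3))) τ := by
  have hsqrt : 0 < √(h₂ τ) := Real.sqrt_pos.2 hpos
  exact ((hd₂.sqrt hpos.ne').inv hsqrt.ne').congr_deriv (by field_simp)

/-- The hypothesis says that `1 / √h''` is 1-Lipschitz. -/
theorem abs_inv_sqrt_sub_inv_sqrt_le (hd₂ : ∀ t ∈ Icc (0 : ℝ) 1, HasDerivAt h₂ (h₃ t) t)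
    (hpos : ∀ t ∈ Icc (0 : ℝ) 1, 0 < h₂ t)
    (hsc : ∀ t ∈ Icc (0 : ℝ) 1, |h₃ t| ≤ 2 * √(h₂ t) ^ 3) (hτ : τ ∈ Icc (0 : ℝ) 1) :
    |(√(h₂ τ))⁻¹ - (√(h₂ 0))⁻¹| ≤ τ := by
  have hlip := Convex.norm_image_sub_le_of_norm_hasDerivWithin_le (C := 1)
    (fun t ht => (hasDerivAt_inv_sqrt (hd₂ t ht) (hpos t ht)).hasDerivWithinAt)
    (fun t ht => ?_) (convex_Icc (0 : ℝ) 1) (left_mem_Icc.2 zero_le_one) hτ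
  · rwa [Real.norm_eq_abs, Real.norm_eq_abs, sub_zero, abs_of_nonneg hτ.1, one_mul] at hlip
  · have hsqrt : 0 < √(h₂ t) := Real.sqrt_pos.2 (hpos t ht)
    rw [norm_neg, Real.norm_eq_abs, abs_div, abs_of_pos (by positivity : 0 < 2 * √(h₂ t) ^ 3),
      div_le_one (by positivity)]
    exact hsc t ht

theorem sqrt_le_sqrt_mul_one_add (hd₂ : ∀ t ∈ Icc (0 : ℝ) 1, HasDerivAt h₂ (h₃ t) t)
    (hpos : ∀ t ∈ Icc (0 : ℝ) 1, 0 < h₂ t)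
    (hsc : ∀ t ∈ Icc (0 : ℝ) 1, |h₃ t| ≤ 2 * √(h₂ t) ^ 3) (hτ : τ ∈ Icc (0 : ℝ) 1) :
    √(h₂ 0) ≤ √(h₂ τ) * (1 + √(h₂ 0) * τ) ∧ √(h₂ τ) * (1 - √(h₂ 0) * τ) ≤ √(h₂ 0) := by
  have hlip := abs_le.1 (abs_inv_sqrt_sub_inv_sqrt_le hd₂ hpos hsc hτ)
  have hr : 0 < √(h₂ 0) := Real.sqrt_pos.2 (hpos 0 (left_mem_Icc.2 zero_le_one))
  have hq : 0 < √(h₂ τ) := Real.sqrt_pos.2 (hpos τ hτ)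
  have hsub : √(h₂ 0) * √(h₂ τ) * ((√(h₂ τ))⁻¹ - (√(h₂ 0))⁻¹) = √(h₂ 0) - √(h₂ τ) := by field_simp
  have hub := mul_le_mul_of_nonneg_left hlip.2 (mul_pos hr hq).le
  have hlb := mul_le_mul_of_nonneg_left hlip.1 (mul_pos hr hq).le
  constructor <;> linarith

theorem mul_div_one_add_le_sub (hd₁ : ∀ t ∈ Icc (0 : ℝ) 1, HasDerivAt h₁ (h₂ t) t)
    (hd₂ : ∀ t ∈ Icc (0 : ℝ) 1, HasDerivAt h₂ (h₃ t) t) (hpos : ∀ t ∈ Icc (0 : ℝ) 1, 0 < h₂ t)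
    (hsc : ∀ t ∈ Icc (0 : ℝ) 1, |h₃ t| ≤ 2 * √(h₂ t) ^ 3) (hτ : τ ∈ Icc (0 : ℝ) 1) :
    √(h₂ 0) * (√(h₂ 0) * τ / (1 + √(h₂ 0) * τ)) ≤ h₁ τ - h₁ 0 := by
  have hden (t : ℝ) (ht : t ∈ Icc (0 : ℝ) 1) : 0 < 1 + √(h₂ 0) * t := by
    have := ht.1
    positivity
  refine le_of_hasDerivAt_le (fun t ht => hasDerivAt_mul_div_one_add _ (hden t ht).ne')
    (fun t ht => (hd₁ t ht).sub_const (h₁ 0)) (by simp) (fun t ht => ?_) hτ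
  rw [← Real.sq_sqrt (hpos t ht).le]
  refine pow_le_pow_left₀ (div_nonneg (Real.sqrt_nonneg _) (hden t ht).le) ?_ 2
  rw [div_le_iff₀ (hden t ht)]
  exact (sqrt_le_sqrt_mul_one_add hd₂ hpos hsc ht).1

theorem sub_le_mul_div_one_sub (hd₁ : ∀ t ∈ Icc (0 : ℝ) 1, HasDerivAt h₁ (h₂ t) t)
    (hd₂ : ∀ t ∈ Icc (0 : ℝ) 1, HasDerivAt h₂ (h₃ t) t) (hpos : ∀ t ∈ Icc (0 : ℝ) 1, 0 < h₂ t)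
    (hsc : ∀ t ∈ Icc (0 : ℝ) 1, |h₃ t| ≤ 2 * √(h₂ t) ^ 3) (hlt : √(h₂ 0) < 1)
    (hτ : τ ∈ Icc (0 : ℝ) 1) :
    h₁ τ - h₁ 0 ≤ √(h₂ 0) * (√(h₂ 0) * τ / (1 - √(h₂ 0) * τ)) := by
  have hden (t : ℝ) (ht : t ∈ Icc (0 : ℝ) 1) : 0 < 1 - √(h₂ 0) * t := by
    nlinarith [ht.1, ht.2, Real.sqrt_nonneg (h₂ 0)]
  have hderiv (t : ℝ) (ht : t ∈ Icc (0 : ℝ) 1) :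
      HasDerivAt (fun t => √(h₂ 0) * (√(h₂ 0) * t / (1 - √(h₂ 0) * t)))
        ((√(h₂ 0) / (1 - √(h₂ 0) * t)) ^ 2) t := by
    simpa [neg_div, sub_eq_add_neg] using
      hasDerivAt_mul_div_one_add (-√(h₂ 0)) (τ := t) (by linarith [hden t ht])
  refine le_of_hasDerivAt_le (fun t ht => (hd₁ t ht).sub_const (h₁ 0)) hderiv (by simp)
    (fun t ht => ?_) hτ
  rw [← Real.sq_sqrt (hpos t ht).le]
  refine pow_le_pow_left₀ (Real.sqrt_nonneg _) ?_ 2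
  rw [le_div_iff₀ (hden t ht)]
  exact (sqrt_le_sqrt_mul_one_add hd₂ hpos hsc ht).2

theorem add_omega_le (hd : ∀ t ∈ Icc (0 : ℝ) 1, HasDerivAt h (h₁ t) t)
    (hd₁ : ∀ t ∈ Icc (0 : ℝ) 1, HasDerivAt h₁ (h₂ t) t)
    (hd₂ : ∀ t ∈ Icc (0 : ℝ) 1, HasDerivAt h₂ (h₃ t) t) (hpos : ∀ t ∈ Icc (0 : ℝ) 1, 0 < h₂ t)
    (hsc : ∀ t ∈ Icc (0 : ℝ) 1, |h₃ t| ≤ 2 * √(h₂ t) ^ 3) :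
    h 0 + h₁ 0 + omega √(h₂ 0) ≤ h 1 := by
  have hderiv (t : ℝ) (ht : t ∈ Icc (0 : ℝ) 1) :
      HasDerivAt (fun t => h 0 + h₁ 0 * t + omega (√(h₂ 0) * t))
        (h₁ 0 + √(h₂ 0) * t / (1 + √(h₂ 0) * t) * √(h₂ 0)) t := by
    have hgt : -1 < √(h₂ 0) * t := by linarith [mul_nonneg (Real.sqrt_nonneg (h₂ 0)) ht.1]
    have hlin (c : ℝ) : HasDerivAt (fun t => c * t) c t := by
      simpa using (hasDerivAt_id t).const_mul c
    exact ((hlin _).const_add _).add ((hasDerivAt_omega hgt).comp t (hlin _))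
  have hle := le_of_hasDerivAt_le hderiv hd (by simp)
    (fun t ht => by linarith [mul_div_one_add_le_sub hd₁ hd₂ hpos hsc ht])
    (right_mem_Icc.2 zero_le_one)
  simpa only [mul_one] using hle

theorem le_add_omegaStar (hd : ∀ t ∈ Icc (0 : ℝ) 1, HasDerivAt h (h₁ t) t)
    (hd₁ : ∀ t ∈ Icc (0 : ℝ) 1, HasDerivAt h₁ (h₂ t) t)
    (hd₂ : ∀ t ∈ Icc (0 : ℝ) 1, HasDerivAt h₂ (h₃ t) t) (hpos : ∀ t ∈ Icc (0 : ℝ) 1, 0 < h₂ t)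
    (hsc : ∀ t ∈ Icc (0 : ℝ) 1, |h₃ t| ≤ 2 * √(h₂ t) ^ 3) (hlt : √(h₂ 0) < 1) :
    h 1 ≤ h 0 + h₁ 0 + omegaStar √(h₂ 0) := by
  have hderiv (t : ℝ) (ht : t ∈ Icc (0 : ℝ) 1) :
      HasDerivAt (fun t => h 0 + h₁ 0 * t + omegaStar (√(h₂ 0) * t))
        (h₁ 0 + √(h₂ 0) * t / (1 - √(h₂ 0) * t) * √(h₂ 0)) t := by
    have hlt' : √(h₂ 0) * t < 1 := by nlinarith [ht.1, ht.2, Real.sqrt_nonneg (h₂ 0)]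
    have hlin (c : ℝ) : HasDerivAt (fun t => c * t) c t := by
      simpa using (hasDerivAt_id t).const_mul c
    exact ((hlin _).const_add _).add ((hasDerivAt_omegaStar hlt').comp t (hlin _))
  have hle := le_of_hasDerivAt_le hd hderiv (by simp)
    (fun t ht => by linarith [sub_le_mul_div_one_sub hd₁ hd₂ hpos hsc hlt ht])
    (right_mem_Icc.2 zero_le_one)
  simpa only [mul_one] using hle

end UnitInterval
end Scalar

section NormedSpace

open Set

variable {E : Type*} [NormedAddCommGroup E] [NormedSpace ℝ E]

/-- The Hessian of `φ` at `u` as a bilinear form. -/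
noncomputable def hessForm (φ : E → ℝ) (u : E) : E →L[ℝ] E →L[ℝ] ℝ := fderiv ℝ (fderiv ℝ φ) u

/-- The third derivative of `φ` at `u` as a trilinear form. -/
noncomputable def thirdForm (φ : E → ℝ) (u : E) : E →L[ℝ] E →L[ℝ] E →L[ℝ] ℝ :=
  fderiv ℝ (hessForm φ) u

/-- The local norm `‖v‖_u = (φ''(u)[v, v])^{1/2}`. -/
noncomputable def localNorm (φ : E → ℝ) (u v : E) : ℝ := √(hessForm φ u v v)

theorem localNorm_nonneg (φ : E → ℝ) (u v : E) : 0 ≤ localNorm φ u v := Real.sqrt_nonneg _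

theorem localNorm_smul (φ : E → ℝ) (u v : E) {t : ℝ} (ht : 0 ≤ t) :
    localNorm φ u (t • v) = t * localNorm φ u v := by
  have hquad : hessForm φ u (t • v) (t • v) = t ^ 2 * hessForm φ u v v := by
    simp only [map_smul, smul_eq_mul, smul_apply]
    ring
  rw [localNorm, hquad, Real.sqrt_mul (sq_nonneg t), Real.sqrt_sq ht, localNorm]

theorem localNorm_neg (φ : E → ℝ) (u v : E) : localNorm φ u (-v) = localNorm φ u v := by
  simp only [localNorm, map_neg, neg_apply, neg_neg]

theorem hasDerivAt_add_smul {F : Type*} [NormedAddCommGroup F] [NormedSpace ℝ F] {f : E → F}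
    {f' : E →L[ℝ] F} {u d : E} {τ : ℝ} (hf : HasFDerivAt f f' (u + τ • d)) :
    HasDerivAt (fun t : ℝ => f (u + t • d)) (f' d) τ := by
  have hline : HasDerivAt (fun t : ℝ => u + t • d) d τ := by
    simpa using ((hasDerivAt_id τ).smul_const d).const_add u
  exact hf.comp_hasDerivAt τ hline

section Symmetry

variable {φ : E → ℝ} {u : E}

theorem hasFDerivAt_fderiv (h : ContDiffAt ℝ 2 φ u) :
    HasFDerivAt (fderiv ℝ φ) (hessForm φ u) u :=
  ((h.fderiv_right (m := 1) (by norm_num)).differentiableAt (by norm_num)).hasFDerivAt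

theorem hasFDerivAt_hessForm (h : ContDiffAt ℝ 3 φ u) :
    HasFDerivAt (hessForm φ) (thirdForm φ u) u :=
  (((h.fderiv_right (m := 2) (by norm_num)).fderiv_right (m := 1)
    (by norm_num)).differentiableAt (by norm_num)).hasFDerivAt

theorem hasDerivAt_fderiv_add_smul {d : E} {τ : ℝ} (h : ContDiffAt ℝ 2 φ (u + τ • d)) (w : E) :
    HasDerivAt (fun t : ℝ => fderiv ℝ φ (u + t • d) w) (hessForm φ (u + τ • d) d w) τ := by
  simpa using (hasDerivAt_add_smul (hasFDerivAt_fderiv h)).clm_apply (hasDerivAt_const τ w)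

theorem hasDerivAt_hessForm_add_smul {d : E} {τ : ℝ} (h : ContDiffAt ℝ 3 φ (u + τ • d)) (w : E) :
    HasDerivAt (fun t : ℝ => hessForm φ (u + t • d) w w) (thirdForm φ (u + τ • d) d w w) τ := by
  have hhess : HasDerivAt (fun t : ℝ => hessForm φ (u + t • d)) (thirdForm φ (u + τ • d) d) τ :=
    hasDerivAt_add_smul (f := hessForm φ) (hasFDerivAt_hessForm h)
  simpa using (hhess.clm_apply (hasDerivAt_const τ w)).clm_apply (hasDerivAt_const τ w)

theorem hessForm_comm (h : ContDiffAt ℝ 2 φ u) (a b : E) :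
    hessForm φ u a b = hessForm φ u b a :=
  h.isSymmSndFDerivAt (by simp) a b

theorem thirdForm_left_comm (h : ContDiffAt ℝ 3 φ u) (a b c : E) :
    thirdForm φ u a b c = thirdForm φ u b a c :=
  DFunLike.congr_fun
    ((h.fderiv_right (m := 2) (by norm_num)).isSymmSndFDerivAt (by simp) a b) c

theorem thirdForm_right_comm (h : ContDiffAt ℝ 3 φ u) (a b c : E) :
    thirdForm φ u a b c = thirdForm φ u a c b := by
  have hderiv (b c : E) : HasFDerivAt (fun v => hessForm φ v b c)
      (((thirdForm φ u).flip b).flip c) u :=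
    (((hasFDerivAt_hessForm h).clm_apply (hasFDerivAt_const b u)).clm_apply
      (hasFDerivAt_const c u)).congr_fderiv (by ext a; simp)
  have hcomm : (fun v => hessForm φ v b c) =ᶠ[𝓝 u] fun v => hessForm φ v c b := by
    filter_upwards [h.eventually (by simp)] with v hv
    exact hessForm_comm (hv.of_le (by norm_num)) b c
  exact DFunLike.congr_fun ((hderiv b c).unique ((hderiv c b).congr_of_eventuallyEq hcomm)) a

end Symmetry

/-- Standard self-concordance on an open convex set, in terms of Fréchet derivatives; the Hessian is
required to be nondegenerate. -/
structure IsSelfConcordantOn (φ : E → ℝ) (D : Set E) : Prop where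
  isOpen : IsOpen D
  convex : Convex ℝ D
  contDiffOn : ContDiffOn ℝ 3 φ D
  hessForm_pos : ∀ u ∈ D, ∀ v, v ≠ 0 → 0 < hessForm φ u v v
  abs_thirdForm_diag_le : ∀ u ∈ D, ∀ v, |thirdForm φ u v v v| ≤ 2 * localNorm φ u v ^ 3

namespace IsSelfConcordantOn

variable {φ : E → ℝ} {D : Set E} (hφ : IsSelfConcordantOn φ D) {u v : E}
include hφ

theorem contDiffAt (hu : u ∈ D) : ContDiffAt ℝ 3 φ u :=
  hφ.contDiffOn.contDiffAt (hφ.isOpen.mem_nhds hu)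

theorem contDiffAt_two (hu : u ∈ D) : ContDiffAt ℝ 2 φ u :=
  (hφ.contDiffAt hu).of_le (by norm_num)

theorem hasFDerivAt (hu : u ∈ D) : HasFDerivAt φ (fderiv ℝ φ u) u :=
  ((hφ.contDiffAt hu).differentiableAt (by norm_num)).hasFDerivAt

theorem hessForm_nonneg (hu : u ∈ D) (v : E) : 0 ≤ hessForm φ u v v := by
  obtain rfl | hv := eq_or_ne v 0
  · simp
  · exact (hφ.hessForm_pos u hu v hv).le

theorem localNorm_sq (hu : u ∈ D) (v : E) : localNorm φ u v ^ 2 = hessForm φ u v v :=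
  Real.sq_sqrt (hφ.hessForm_nonneg hu v)

theorem thirdForm_le (hu : u ∈ D) (a b : E) :
    thirdForm φ u a b b ≤ 2 * localNorm φ u a * hessForm φ u b b := by
  have hC3 := hφ.contDiffAt hu
  let B : E →ₗ[ℝ] E →ₗ[ℝ] ℝ := ContinuousLinearMap.coeLM ℝ ∘ₗ (hessForm φ u).toLinearMap
  let T : E →ₗ[ℝ] E →ₗ[ℝ] E →ₗ[ℝ] ℝ :=
    (LinearMap.compRight ℝ (ContinuousLinearMap.coeLM ℝ : (E →L[ℝ] ℝ) →ₗ[ℝ] E →ₗ[ℝ] ℝ)) ∘ₗ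
      ContinuousLinearMap.coeLM ℝ ∘ₗ (thirdForm φ u).toLinearMap
  have htri := trilinear_apply_le_of_posDef (B := B) (T := T)
    (hessForm_comm (hφ.contDiffAt_two hu)) (hφ.hessForm_pos u hu) (thirdForm_left_comm hC3)
    (thirdForm_right_comm hC3) (fun a => (abs_le.1 (hφ.abs_thirdForm_diag_le u hu a)).2) a b
  rw [← hφ.localNorm_sq hu]
  exact htri

theorem abs_thirdForm_le (hu : u ∈ D) (a b : E) :
    |thirdForm φ u a b b| ≤ 2 * localNorm φ u a * hessForm φ u b b := by
  have hneg := hφ.thirdForm_le hu (-a) b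
  simp only [map_neg, neg_apply, localNorm, neg_neg] at hneg
  exact abs_le.2 ⟨neg_le.1 hneg, hφ.thirdForm_le hu a b⟩

section Segment

variable (hu : u ∈ D) (hv : v ∈ D)
include hu hv

theorem line_mem {τ : ℝ} (hτ : τ ∈ Icc (0 : ℝ) 1) : u + τ • (v - u) ∈ D :=
  hφ.convex.add_smul_sub_mem hu hv hτ

theorem hasDerivAt_line {τ : ℝ} (hτ : τ ∈ Icc (0 : ℝ) 1) :
    HasDerivAt (fun t : ℝ => φ (u + t • (v - u))) (fderiv ℝ φ (u + τ • (v - u)) (v - u)) τ :=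
  hasDerivAt_add_smul (hφ.hasFDerivAt (hφ.line_mem hu hv hτ))

theorem hasDerivAt_fderiv_line (w : E) {τ : ℝ} (hτ : τ ∈ Icc (0 : ℝ) 1) :
    HasDerivAt (fun t : ℝ => fderiv ℝ φ (u + t • (v - u)) w)
      (hessForm φ (u + τ • (v - u)) (v - u) w) τ :=
  hasDerivAt_fderiv_add_smul (hφ.contDiffAt_two (hφ.line_mem hu hv hτ)) w

theorem hasDerivAt_hessForm_line (w : E) {τ : ℝ} (hτ : τ ∈ Icc (0 : ℝ) 1) :
    HasDerivAt (fun t : ℝ => hessForm φ (u + t • (v - u)) w w)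
      (thirdForm φ (u + τ • (v - u)) (v - u) w w) τ :=
  hasDerivAt_hessForm_add_smul (hφ.contDiffAt (hφ.line_mem hu hv hτ)) w

theorem localNorm_line_le {τ : ℝ} (hτ : τ ∈ Icc (0 : ℝ) 1) :
    localNorm φ (u + τ • (v - u)) (v - u) * (1 - localNorm φ u (v - u) * τ) ≤
      localNorm φ u (v - u) := by
  obtain huv | huv := eq_or_ne (v - u) 0
  · simp [huv, localNorm]
  have hsqrt := sqrt_le_sqrt_mul_one_add (fun t => hφ.hasDerivAt_hessForm_line hu hv (v - u))
    (fun t ht => hφ.hessForm_pos _ (hφ.line_mem hu hv ht) _ huv)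
    (fun t ht => hφ.abs_thirdForm_diag_le _ (hφ.line_mem hu hv ht) _) hτ
  simpa [localNorm] using hsqrt.2

theorem localNorm_sq_div_le_fderiv_sub :
    localNorm φ u (v - u) * (localNorm φ u (v - u) / (1 + localNorm φ u (v - u))) ≤
      fderiv ℝ φ v (v - u) - fderiv ℝ φ u (v - u) := by
  obtain huv | huv := eq_or_ne (v - u) 0
  · simp [huv, localNorm]
  have hgrad := mul_div_one_add_le_sub (fun t => hφ.hasDerivAt_fderiv_line hu hv (v - u))
    (fun t => hφ.hasDerivAt_hessForm_line hu hv (v - u))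
    (fun t ht => hφ.hessForm_pos _ (hφ.line_mem hu hv ht) _ huv)
    (fun t ht => hφ.abs_thirdForm_diag_le _ (hφ.line_mem hu hv ht) _)
    (right_mem_Icc.2 zero_le_one)
  simpa [localNorm] using hgrad

theorem add_omega_localNorm_le :
    φ u + fderiv ℝ φ u (v - u) + omega (localNorm φ u (v - u)) ≤ φ v := by
  obtain rfl | huv := eq_or_ne v u
  · simp [localNorm]
  have hle := add_omega_le (fun t => hφ.hasDerivAt_line hu hv)
    (fun t => hφ.hasDerivAt_fderiv_line hu hv (v - u))
    (fun t => hφ.hasDerivAt_hessForm_line hu hv (v - u))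
    (fun t ht => hφ.hessForm_pos _ (hφ.line_mem hu hv ht) _ (sub_ne_zero.2 huv))
    (fun t ht => hφ.abs_thirdForm_diag_le _ (hφ.line_mem hu hv ht) _)
  simpa [localNorm] using hle

theorem le_add_omegaStar_localNorm (hlt : localNorm φ u (v - u) < 1) :
    φ v ≤ φ u + fderiv ℝ φ u (v - u) + omegaStar (localNorm φ u (v - u)) := by
  obtain rfl | huv := eq_or_ne v u
  · simp [localNorm]
  have hle := le_add_omegaStar (fun t => hφ.hasDerivAt_line hu hv)
    (fun t => hφ.hasDerivAt_fderiv_line hu hv (v - u))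
    (fun t => hφ.hasDerivAt_hessForm_line hu hv (v - u))
    (fun t ht => hφ.hessForm_pos _ (hφ.line_mem hu hv ht) _ (sub_ne_zero.2 huv))
    (fun t ht => hφ.abs_thirdForm_diag_le _ (hφ.line_mem hu hv ht) _)
    (by simpa [localNorm] using hlt)
  simpa [localNorm] using hle

theorem hessForm_comparison (hlt : localNorm φ u (v - u) < 1) (w : E) :
    (1 - localNorm φ u (v - u)) ^ 2 * hessForm φ v w w ≤ hessForm φ u w w ∧
      (1 - localNorm φ u (v - u)) ^ 2 * hessForm φ u w w ≤ hessForm φ v w w := by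
  set r := localNorm φ u (v - u)
  have hr : 0 ≤ r := localNorm_nonneg φ u (v - u)
  have hbound (t : ℝ) (ht : t ∈ Icc (0 : ℝ) 1) :
      |thirdForm φ (u + t • (v - u)) (v - u) w w| * (1 - r * t) ≤
        2 * r * hessForm φ (u + t • (v - u)) w w := by
    have hmem := hφ.line_mem hu hv ht
    have hden : 0 ≤ 1 - r * t := by nlinarith [ht.1, ht.2]
    linarith [mul_le_mul_of_nonneg_right (hφ.abs_thirdForm_le hmem (v - u) w) hden,
      mul_le_mul_of_nonneg_right (hφ.localNorm_line_le hu hv ht) (hφ.hessForm_nonneg hmem w)]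
  simpa using one_sub_sq_mul_le_of_abs_deriv_le hr hlt
    (fun t => hφ.hasDerivAt_hessForm_line hu hv w) hbound

end Segment

end IsSelfConcordantOn

end NormedSpace

section Minimizers

open Set

theorem subset_of_isClosed_epigraph {X : Type*} [TopologicalSpace X] {φ : X → ℝ} {S D : Set X}
    {M : ℝ} (hS : IsPreconnected S) (hD : IsOpen D)
    (hepi : IsClosed {q : X × ℝ | q.1 ∈ D ∧ φ q.1 ≤ q.2}) (hne : (S ∩ D).Nonempty)
    (hM : ∀ w ∈ S ∩ D, φ w ≤ M) : S ⊆ D := by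
  have hsub : IsClosed {w | w ∈ D ∧ φ w ≤ M} :=
    hepi.preimage (Continuous.prodMk continuous_id continuous_const)
  intro w hw
  by_contra hwD
  obtain ⟨z, hzS, hzD, hz⟩ := hS D _ hD hsub.isOpen_compl
    (fun z _ => or_iff_not_imp_left.2 fun hzD hz => hzD hz.1) hne ⟨w, hw, fun h => hwD h.1⟩
  exact hz ⟨hzD, hM z ⟨hzS, hzD⟩⟩

variable {E : Type*} [NormedAddCommGroup E] [NormedSpace ℝ E]

theorem isCoercive_of_forall_pos [FiniteDimensional ℝ E] {B : E →L[ℝ] E →L[ℝ] ℝ}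
    (hB : ∀ v, v ≠ 0 → 0 < B v v) : IsCoercive B := by
  obtain hE | hE := subsingleton_or_nontrivial E
  · exact ⟨1, one_pos, fun v => by simp [Subsingleton.elim v 0]⟩
  have : ProperSpace E := FiniteDimensional.proper ℝ E
  obtain ⟨z, hz, hmin⟩ := (isCompact_sphere (0 : E) 1).exists_isMinOn
    (NormedSpace.sphere_nonempty.2 zero_le_one)
    (by fun_prop : Continuous fun v => B v v).continuousOn
  refine ⟨B z z, hB z (ne_zero_of_mem_unit_sphere ⟨z, hz⟩), fun v => ?_⟩
  obtain rfl | hv := eq_or_ne v 0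
  · simp
  have hv' : 0 < ‖v‖ := norm_pos_iff.2 hv
  have hle : B z z ≤ B (‖v‖⁻¹ • v) (‖v‖⁻¹ • v) := hmin (by simp [norm_smul, hv'.ne'])
  simp only [map_smul, smul_apply, smul_eq_mul, inv_mul_eq_div] at hle
  rwa [le_div_iff₀ hv', le_div_iff₀ hv'] at hle

namespace IsSelfConcordantOn

variable {φ : E → ℝ} {D : Set E} (hφ : IsSelfConcordantOn φ D) {u v : E} {ℓ : E →L[ℝ] ℝ} {lam : ℝ}
include hφ

/-- On the part of `[u, v]` inside the domain, `φ` stays bounded, so the segment cannot leave it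
through the boundary, where `φ` blows up. -/
theorem mem_of_localNorm_lt_one (hepi : IsClosed {q : E × ℝ | q.1 ∈ D ∧ φ q.1 ≤ q.2})
    (hu : u ∈ D) (hlt : localNorm φ u (v - u) < 1) : v ∈ D := by
  refine subset_of_isClosed_epigraph
    (M := φ u + |fderiv ℝ φ u (v - u)| + omegaStar (localNorm φ u (v - u)))
    (convex_segment u v).isPreconnected hφ.isOpen hepi ⟨u, left_mem_segment ℝ u v, hu⟩ ?_
    (right_mem_segment ℝ u v)
  rintro w ⟨hwS, hwD⟩
  obtain ⟨t, ht, rfl⟩ := (segment_eq_image' ℝ u v).subset hwS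
  have hr := localNorm_nonneg φ u (v - u)
  have htr : t * localNorm φ u (v - u) ≤ localNorm φ u (v - u) := mul_le_of_le_one_left hr ht.2
  have hle := hφ.le_add_omegaStar_localNorm hu hwD
  rw [add_sub_cancel_left, localNorm_smul φ u _ ht.1, map_smul, smul_eq_mul] at hle
  have hmono := monotoneOn_omegaStar ⟨mul_nonneg ht.1 hr, htr.trans_lt hlt⟩ ⟨hr, hlt⟩ htr
  have hlin : t * fderiv ℝ φ u (v - u) ≤ |fderiv ℝ φ u (v - u)| :=
    (mul_le_mul_of_nonneg_left (le_abs_self _) ht.1).trans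
      (mul_le_of_le_one_left (abs_nonneg _) ht.2)
  linarith [hle (htr.trans_lt hlt)]

theorem isMinOn_sub_iff (hv : v ∈ D) :
    IsMinOn (fun w => φ w - ℓ w) D v ↔ fderiv ℝ φ v = ℓ := by
  refine ⟨fun hmin => ?_, fun hgrad w hw => ?_⟩
  · exact sub_eq_zero.1 ((hmin.isLocalMin (hφ.isOpen.mem_nhds hv)).hasFDerivAt_eq_zero
      ((hφ.hasFDerivAt hv).sub ℓ.hasFDerivAt))
  · have hle := hφ.add_omega_localNorm_le hv hw
    rw [hgrad, map_sub] at hle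
    change φ v - ℓ v ≤ φ w - ℓ w
    linarith [omega_nonneg (localNorm_nonneg φ v (w - v))]

theorem localNorm_sub_le_of_isMinOn (hu : u ∈ D) (hv : v ∈ D) (hlam₀ : 0 ≤ lam) (hlam₁ : lam < 1)
    (hgrad : ∀ w, ℓ w - fderiv ℝ φ u w ≤ lam * localNorm φ u w)
    (hmin : IsMinOn (fun w => φ w - ℓ w) D v) :
    localNorm φ u (v - u) ≤ lam / (1 - lam) := by
  have hle := hφ.localNorm_sq_div_le_fderiv_sub hu hv
  rw [(hφ.isMinOn_sub_iff hv).1 hmin] at hle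
  replace hle := hle.trans (hgrad (v - u))
  rw [mul_comm lam] at hle
  rw [le_div_iff₀ (by linarith)]
  obtain hr | hr := (localNorm_nonneg φ u (v - u)).eq_or_lt
  · simpa [← hr] using hlam₀
  · have hdiv := le_of_mul_le_mul_left hle hr
    rw [div_le_iff₀ (by linarith)] at hdiv
    linarith

/-- Fenchel's inequality for `ω` at the slope `(1 + lam) / 2`, between `lam` and `1`, turns
`ω(r) ≤ lam r` into a bound on `r`. -/
theorem localNorm_sub_le_of_sub_le (hu : u ∈ D) (hv : v ∈ D) (hlam : lam < 1)
    (hgrad : ∀ w, ℓ w - fderiv ℝ φ u w ≤ lam * localNorm φ u w)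
    (hle : φ v - ℓ v ≤ φ u - ℓ u) :
    localNorm φ u (v - u) ≤ omegaStar ((1 + lam) / 2) / ((1 - lam) / 2) := by
  have hr := localNorm_nonneg φ u (v - u)
  have hfenchel := mul_sub_omega_le_omegaStar (r := (1 + lam) / 2) (by linarith)
    (by linarith : -1 < localNorm φ u (v - u))
  have hgrad' := hgrad (v - u)
  rw [map_sub ℓ] at hgrad'
  rw [le_div_iff₀ (by linarith)]
  linarith [hφ.add_omega_localNorm_le hu hv]

theorem exists_isMinOn_sub [FiniteDimensional ℝ E]
    (hepi : IsClosed {q : E × ℝ | q.1 ∈ D ∧ φ q.1 ≤ q.2}) (hu : u ∈ D) (hlam : lam < 1)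
    (hgrad : ∀ w, ℓ w - fderiv ℝ φ u w ≤ lam * localNorm φ u w) :
    ∃ v ∈ D, IsMinOn (fun w => φ w - ℓ w) D v := by
  let K : Set E := {v | v ∈ D ∧ φ v ≤ φ u - ℓ u + ℓ v}
  have hK_closed : IsClosed K := hepi.preimage (f := fun v => (v, φ u - ℓ u + ℓ v)) (by fun_prop)
  obtain ⟨c, hc, hcoercive⟩ := isCoercive_of_forall_pos (hφ.hessForm_pos u hu)
  have hK_ball : K ⊆ Metric.closedBall u
      (omegaStar ((1 + lam) / 2) / ((1 - lam) / 2) / √c) := by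
    rintro v ⟨hv, hle⟩
    have hnorm : √c * ‖v - u‖ ≤ localNorm φ u (v - u) := by
      refine Real.le_sqrt_of_sq_le ?_
      rw [mul_pow, Real.sq_sqrt hc.le, sq, ← mul_assoc]
      exact hcoercive (v - u)
    rw [mem_closedBall_iff_norm, le_div_iff₀' (Real.sqrt_pos.2 hc)]
    exact hnorm.trans (hφ.localNorm_sub_le_of_sub_le hu hv hlam hgrad (by linarith))
  have : ProperSpace E := FiniteDimensional.proper ℝ E
  have hcont : ContinuousOn (fun v => φ v - ℓ v) K := fun w hw =>
    ((hφ.contDiffAt hw.1).continuousAt.sub ℓ.continuous.continuousAt).continuousWithinAt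
  obtain ⟨v, hv, hmin⟩ := ((isCompact_closedBall _ _).of_isClosed_subset hK_closed
    hK_ball).exists_isMinOn ⟨u, hu, by simp⟩ hcont
  refine ⟨v, hv.1, fun w hw => ?_⟩
  by_cases hwK : w ∈ K
  · exact hmin hwK
  · have hlt : φ u - ℓ u + ℓ w < φ w := not_le.1 fun h => hwK ⟨hw, h⟩
    change φ v - ℓ v ≤ φ w - ℓ w
    linarith [hv.2]

end IsSelfConcordantOn

end Minimizers

section Matrix

variable {ι : Type*}

theorem posSemidef_sub_smul_of_le {P Q : Matrix ι ι ℝ} (hP : P.PosSemidef) {a b : ℝ} (hab : a ≤ b)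
    (h : (Q - b • P).PosSemidef) : (Q - a • P).PosSemidef := by
  have hadd := h.add (hP.smul (sub_nonneg.2 hab))
  rwa [sub_smul, sub_add_sub_cancel] at hadd

variable [Fintype ι]

theorem dotProduct_mulVec_comm {P : Matrix ι ι ℝ} (hP : P.IsHermitian) (v w : ι → ℝ) :
    v ⬝ᵥ (P *ᵥ w) = w ⬝ᵥ (P *ᵥ v) := by
  have htranspose : Pᵀ = P := by
    rw [← Matrix.conjTranspose_eq_transpose_of_trivial, hP.eq]
  rw [← Matrix.dotProduct_transpose_mulVec, htranspose]

theorem dotProduct_mulVec_self_nonneg {P : Matrix ι ι ℝ} (hP : P.PosSemidef) (v : ι → ℝ) :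
    0 ≤ v ⬝ᵥ (P *ᵥ v) := by
  simpa only [star_trivial] using hP.dotProduct_mulVec_nonneg v

theorem posSemidef_sub_smul_iff {P Q : Matrix ι ι ℝ} (hP : P.IsHermitian) (hQ : Q.IsHermitian)
    {c : ℝ} : (Q - c • P).PosSemidef ↔ ∀ v, c * (v ⬝ᵥ (P *ᵥ v)) ≤ v ⬝ᵥ (Q *ᵥ v) := by
  have hform (v : ι → ℝ) :
      star v ⬝ᵥ ((Q - c • P) *ᵥ v) = v ⬝ᵥ (Q *ᵥ v) - c * (v ⬝ᵥ (P *ᵥ v)) := by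
    rw [star_trivial, Matrix.sub_mulVec, Matrix.smul_mulVec, dotProduct_sub, dotProduct_smul,
      smul_eq_mul]
  have hherm : (Q - c • P).IsHermitian := hQ.sub (hP.smul (IsSelfAdjoint.all c))
  simp only [Matrix.posSemidef_iff_dotProduct_mulVec, hherm, true_and, hform, sub_nonneg]

variable [DecidableEq ι]

theorem mulVec_inv_mulVec {P : Matrix ι ι ℝ} (hP : IsUnit P) (w : ι → ℝ) :
    P *ᵥ (P⁻¹ *ᵥ w) = w := by
  rw [Matrix.mulVec_mulVec, Matrix.mul_nonsing_inv _ ((Matrix.isUnit_iff_isUnit_det P).1 hP),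
    Matrix.one_mulVec]

theorem inv_mulVec_mulVec {P : Matrix ι ι ℝ} (hP : IsUnit P) (w : ι → ℝ) :
    P⁻¹ *ᵥ (P *ᵥ w) = w := by
  rw [Matrix.mulVec_mulVec, Matrix.nonsing_inv_mul _ ((Matrix.isUnit_iff_isUnit_det P).1 hP),
    Matrix.one_mulVec]

theorem dotProduct_sq_le {P : Matrix ι ι ℝ} (hP : P.PosDef) (v w : ι → ℝ) :
    (v ⬝ᵥ w) ^ 2 ≤ (v ⬝ᵥ (P *ᵥ v)) * (w ⬝ᵥ (P⁻¹ *ᵥ w)) := by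
  have h := LinearMap.BilinForm.apply_mul_apply_le_of_forall_zero_le (Matrix.toLinearMap₂' ℝ P)
    (fun v => by
      rw [Matrix.toLinearMap₂'_apply']
      exact dotProduct_mulVec_self_nonneg hP.posSemidef v) v (P⁻¹ *ᵥ w)
  simp only [Matrix.toLinearMap₂'_apply'] at h
  rwa [dotProduct_mulVec_comm hP.isHermitian (P⁻¹ *ᵥ w) v, mulVec_inv_mulVec hP.isUnit, ← sq,
    dotProduct_comm (P⁻¹ *ᵥ w)] at h

theorem two_mul_dotProduct_sub_le {P : Matrix ι ι ℝ} (hP : P.PosDef) (v w : ι → ℝ) :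
    2 * (v ⬝ᵥ w) - v ⬝ᵥ (P *ᵥ v) ≤ w ⬝ᵥ (P⁻¹ *ᵥ w) := by
  have h := dotProduct_mulVec_self_nonneg hP.posSemidef (v - P⁻¹ *ᵥ w)
  rw [Matrix.mulVec_sub, mulVec_inv_mulVec hP.isUnit, sub_dotProduct, dotProduct_sub,
    dotProduct_sub, dotProduct_mulVec_comm hP.isHermitian (P⁻¹ *ᵥ w) v,
    mulVec_inv_mulVec hP.isUnit, dotProduct_comm (P⁻¹ *ᵥ w) w] at h
  linarith

theorem posSemidef_inv_sub_smul_inv {P Q : Matrix ι ι ℝ} (hP : P.PosDef) (hQ : Q.PosDef) {c : ℝ}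
    (hc : 0 ≤ c) (h : (Q - c • P).PosSemidef) : (P⁻¹ - c • Q⁻¹).PosSemidef := by
  rw [posSemidef_sub_smul_iff hQ.inv.isHermitian hP.inv.isHermitian]
  intro w
  have hvar := two_mul_dotProduct_sub_le hP (c • (Q⁻¹ *ᵥ w)) w
  have hle := (posSemidef_sub_smul_iff hP.isHermitian hQ.isHermitian).1 h (Q⁻¹ *ᵥ w)
  rw [mulVec_inv_mulVec hQ.isUnit, dotProduct_comm _ w] at hle
  simp only [Matrix.mulVec_smul, smul_dotProduct, dotProduct_smul, smul_eq_mul,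
    dotProduct_comm (Q⁻¹ *ᵥ w) w] at hvar
  linarith [mul_le_mul_of_nonneg_left hle hc]

end Matrix

section Congruence

variable {ι κ : Type*} [Fintype ι]

theorem posSemidef_mul_mul_transpose_sub_smul [Finite κ] (A : Matrix κ ι ℝ)
    {P Q : Matrix ι ι ℝ} {c : ℝ}
    (h : (Q - c • P).PosSemidef) : (A * Q * Aᵀ - c • (A * P * Aᵀ)).PosSemidef := by
  simpa only [Matrix.mul_sub, Matrix.sub_mul, Matrix.mul_smul, Matrix.smul_mul,
    Matrix.conjTranspose_eq_transpose_of_trivial] using h.mul_mul_conjTranspose_same A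

variable [Fintype κ]

theorem dotProduct_mul_mul_transpose_mulVec (A : Matrix κ ι ℝ) (R : Matrix ι ι ℝ) (v w : κ → ℝ) :
    v ⬝ᵥ ((A * R * Aᵀ) *ᵥ w) = (Aᵀ *ᵥ v) ⬝ᵥ (R *ᵥ (Aᵀ *ᵥ w)) := by
  rw [← Matrix.mulVec_mulVec, ← Matrix.mulVec_mulVec, Matrix.dotProduct_mulVec,
    Matrix.mulVec_transpose A v]

theorem posDef_mul_mul_transpose {A : Matrix κ ι ℝ} (hA : A.rank = Fintype.card κ)
    {R : Matrix ι ι ℝ} (hR : R.PosDef) : (A * R * Aᵀ).PosDef := by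
  refine hR.mul_mul_conjTranspose_same (Matrix.vecMul_injective_iff.2 ?_)
  rw [linearIndependent_iff_card_eq_finrank_span, Set.finrank, ← Matrix.rank_eq_finrank_span_row,
    hA]

end Congruence

section WeightedNorm

variable {n p : ℕ}

theorem wnorm_nonneg (P : Matrix (Fin n) (Fin n) ℝ) (v : Fin n → ℝ) : 0 ≤ wnorm P v :=
  Real.sqrt_nonneg _

theorem wnorm_sq {P : Matrix (Fin n) (Fin n) ℝ} (hP : P.PosSemidef) (v : Fin n → ℝ) :
    wnorm P v ^ 2 = v ⬝ᵥ (P *ᵥ v) :=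
  Real.sq_sqrt (dotProduct_mulVec_self_nonneg hP v)

theorem wnorm_mul_mul_transpose (A : Matrix (Fin p) (Fin n) ℝ) (R : Matrix (Fin n) (Fin n) ℝ)
    (v : Fin p → ℝ) : wnorm (A * R * Aᵀ) v = wnorm R (Aᵀ *ᵥ v) := by
  rw [wnorm, dotProduct_mul_mul_transpose_mulVec, wnorm]

theorem wnorm_inv_mulVec {P : Matrix (Fin n) (Fin n) ℝ} (hP : IsUnit P) (w : Fin n → ℝ) :
    wnorm P (P⁻¹ *ᵥ w) = wnormDual P w := by
  rw [wnorm, mulVec_inv_mulVec hP, dotProduct_comm, wnormDual, wnorm]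

theorem abs_dotProduct_le_wnorm_mul_wnormDual {P : Matrix (Fin n) (Fin n) ℝ} (hP : P.PosDef)
    (v w : Fin n → ℝ) : |v ⬝ᵥ w| ≤ wnorm P v * wnormDual P w := by
  refine abs_le_of_sq_le_sq ?_ (mul_nonneg (wnorm_nonneg _ _) (wnorm_nonneg _ _))
  rw [mul_pow, wnorm_sq hP.posSemidef, wnormDual, wnorm_sq hP.inv.posSemidef]
  exact dotProduct_sq_le hP v w

theorem wnormDual_le {P : Matrix (Fin n) (Fin n) ℝ} (hP : P.PosDef) {w : Fin n → ℝ} {c : ℝ}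
    (hc : 0 ≤ c) (h : ∀ v, w ⬝ᵥ v ≤ c * wnorm P v) : wnormDual P w ≤ c := by
  have hsq : wnormDual P w * wnormDual P w ≤ c * wnormDual P w := by
    rw [← sq, wnormDual, wnorm_sq hP.inv.posSemidef]
    exact (h _).trans_eq (congrArg _ (wnorm_inv_mulVec hP.isUnit w))
  rcases (wnorm_nonneg P⁻¹ w).eq_or_lt with hzero | hpos
  · exact hzero.symm.trans_le hc
  · exact le_of_mul_le_mul_right hsq hpos

theorem mul_wnorm_le_wnorm {P Q : Matrix (Fin n) (Fin n) ℝ} (hP : P.IsHermitian)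
    (hQ : Q.IsHermitian) {c : ℝ} (hc : 0 ≤ c) (h : (Q - c ^ 2 • P).PosSemidef) (v : Fin n → ℝ) :
    c * wnorm P v ≤ wnorm Q v :=
  calc c * wnorm P v = Real.sqrt (c ^ 2 * (v ⬝ᵥ (P *ᵥ v))) := by
        rw [Real.sqrt_mul (sq_nonneg c), Real.sqrt_sq hc, wnorm]
    _ ≤ wnorm Q v := Real.sqrt_le_sqrt ((posSemidef_sub_smul_iff hP hQ).1 h v)

end WeightedNorm

section Coordinates

variable {n : ℕ} {φ : (Fin n → ℝ) → ℝ}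

theorem grad_dotProduct (u w : Fin n → ℝ) : grad φ u ⬝ᵥ w = fderiv ℝ φ u w := by
  conv_rhs => rw [pi_eq_sum_univ' w]
  simp only [map_sum, map_smul, dotProduct, grad, smul_eq_mul, mul_comm]

theorem dotProduct_hess_mulVec (u v w : Fin n → ℝ) :
    v ⬝ᵥ (hess φ u *ᵥ w) = hessForm φ u v w := by
  let B : (Fin n → ℝ) →ₗ[ℝ] (Fin n → ℝ) →ₗ[ℝ] ℝ :=
    ContinuousLinearMap.coeLM ℝ ∘ₗ (hessForm φ u).toLinearMap
  have hB : hess φ u = LinearMap.toMatrix₂' ℝ B := by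
    ext i j
    rw [LinearMap.toMatrix₂'_apply]
    rfl
  rw [hB, ← Matrix.toLinearMap₂'_apply', Matrix.toLinearMap₂'_toMatrix']
  rfl

theorem wnorm_hess (u v : Fin n → ℝ) : wnorm (hess φ u) v = localNorm φ u v := by
  rw [wnorm, dotProduct_hess_mulVec, localNorm]

end Coordinates

section Line

variable {E : Type*} [NormedAddCommGroup E] [NormedSpace ℝ E] {φ : E → ℝ} {u v : E} {τ : ℝ}

theorem eventually_contDiffAt_add_smul {k : ℕ} (h : ContDiffAt ℝ k φ (u + τ • v)) :
    ∀ᶠ t in 𝓝 τ, ContDiffAt ℝ k φ (u + t • v) :=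
  (show Continuous fun t : ℝ => u + t • v by fun_prop).continuousAt.eventually
    (h.eventually (by simp))

theorem iteratedDeriv_two_add_smul (h : ContDiffAt ℝ 2 φ (u + τ • v)) :
    iteratedDeriv 2 (fun t : ℝ => φ (u + t • v)) τ = hessForm φ (u + τ • v) v v := by
  have hderiv : deriv (fun t : ℝ => φ (u + t • v)) =ᶠ[𝓝 τ] fun t => fderiv ℝ φ (u + t • v) v :=
    (eventually_contDiffAt_add_smul h).mono fun t ht =>
      (hasDerivAt_add_smul (ht.differentiableAt (by norm_num)).hasFDerivAt).deriv
  rw [iteratedDeriv_succ, iteratedDeriv_one, hderiv.deriv_eq,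
    (hasDerivAt_fderiv_add_smul h v).deriv]

theorem iteratedDeriv_three_add_smul (h : ContDiffAt ℝ 3 φ (u + τ • v)) :
    iteratedDeriv 3 (fun t : ℝ => φ (u + t • v)) τ = thirdForm φ (u + τ • v) v v v := by
  have hderiv : iteratedDeriv 2 (fun t : ℝ => φ (u + t • v)) =ᶠ[𝓝 τ]
      fun t => hessForm φ (u + t • v) v v :=
    (eventually_contDiffAt_add_smul h).mono fun t ht =>
      iteratedDeriv_two_add_smul (ht.of_le (by norm_num))
  rw [iteratedDeriv_succ, hderiv.deriv_eq, (hasDerivAt_hessForm_add_smul h v).deriv]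

end Line

theorem IsStandardSelfConcordant.isSelfConcordantOn {n : ℕ} {φ : (Fin n → ℝ) → ℝ}
    {D : Set (Fin n → ℝ)} (hφ : IsStandardSelfConcordant φ D) : IsSelfConcordantOn φ D where
  isOpen := hφ.isOpen
  convex := hφ.convexOn.1
  contDiffOn := hφ.contDiffOn
  hessForm_pos u hu v hv := by
    simpa only [star_trivial, dotProduct_hess_mulVec]
      using (hφ.hess_posDef u hu).dotProduct_mulVec_pos hv
  abs_thirdForm_diag_le u hu v := by
    have hsmooth : ContDiffAt ℝ 3 φ (u + (0 : ℝ) • v) := by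
      simpa using hφ.contDiffOn.contDiffAt (hφ.isOpen.mem_nhds hu)
    have hbound := (hφ.along_lines u hu v).bound 0 (by simpa using hu)
    rw [iteratedDeriv_three_add_smul hsmooth,
      iteratedDeriv_two_add_smul (hsmooth.of_le (by norm_num)), zero_smul, add_zero] at hbound
    have hnonneg : 0 ≤ hessForm φ u v v := by
      rw [← dotProduct_hess_mulVec]
      exact dotProduct_mulVec_self_nonneg (hφ.hess_posDef u hu).posSemidef v
    refine hbound.trans_eq ?_
    rw [localNorm, Real.sqrt_eq_rpow, ← Real.rpow_natCast, ← Real.rpow_mul hnonneg]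
    norm_num

section Gradient

variable {n : ℕ} {φ : (Fin n → ℝ) → ℝ}

/-- The linear functional `⟨w, ·⟩`. -/
noncomputable def dotProductCLM (w : Fin n → ℝ) : (Fin n → ℝ) →L[ℝ] ℝ :=
  (dotProductBilin ℝ ℝ w).toContinuousLinearMap

theorem dotProductCLM_apply (w v : Fin n → ℝ) : dotProductCLM w v = w ⬝ᵥ v := rfl

theorem fderiv_eq_dotProductCLM_iff {u w : Fin n → ℝ} :
    fderiv ℝ φ u = dotProductCLM w ↔ grad φ u = w := by
  have hgrad : fderiv ℝ φ u = dotProductCLM (grad φ u) :=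
    ContinuousLinearMap.ext fun v => (grad_dotProduct u v).symm
  refine ⟨fun h => funext fun i => ?_, fun h => h ▸ hgrad⟩
  rw [grad, h, dotProductCLM_apply, dotProduct_single_one]

theorem grad_eq_of_eventually_le {u g : Fin n → ℝ} (hφ : DifferentiableAt ℝ φ u)
    (h : ∀ᶠ v in 𝓝 u, φ u + g ⬝ᵥ (v - u) ≤ φ v) : grad φ u = g := by
  have hmin : IsLocalMin (fun v => φ v - dotProductCLM g v) u := by
    filter_upwards [h] with v hv
    rw [dotProduct_sub] at hv
    simp only [dotProductCLM_apply]
    linarith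
  exact fderiv_eq_dotProductCLM_iff.1 (sub_eq_zero.1
    (hmin.hasFDerivAt_eq_zero (hφ.hasFDerivAt.sub (dotProductCLM g).hasFDerivAt)))

theorem contDiffAt_grad {u : Fin n → ℝ} (hφ : ContDiffAt ℝ 3 φ u) : ContDiffAt ℝ 2 (grad φ) u :=
  contDiffAt_pi.2 fun _ =>
    (hφ.fderiv_right (m := 2) (by norm_num)).clm_apply contDiffAt_const

theorem hasFDerivAt_grad {u : Fin n → ℝ} (hφ : ContDiffAt ℝ 2 φ u) :
    HasFDerivAt (grad φ) (hess φ u).mulVecLin.toContinuousLinearMap u := by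
  refine hasFDerivAt_pi'.2 fun i =>
    ((hasFDerivAt_fderiv hφ).clm_apply (hasFDerivAt_const (Pi.single i 1) u)).congr_fderiv ?_
  ext1 w
  have hi : (hess φ u *ᵥ w) i = hessForm φ u w (Pi.single i 1) := by
    rw [hessForm_comm hφ, ← dotProduct_hess_mulVec, single_one_dotProduct]
  simpa using hi.symm

/-- An invertible matrix acting on column vectors, packaged for the inverse function theorem. -/
noncomputable def mulVecEquiv {P : Matrix (Fin n) (Fin n) ℝ} (hP : IsUnit P) :
    (Fin n → ℝ) ≃L[ℝ] (Fin n → ℝ) :=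
  (LinearEquiv.ofLinearMap P.mulVecLin P⁻¹.mulVecLin
    (LinearMap.ext (mulVec_inv_mulVec hP))
    (LinearMap.ext (inv_mulVec_mulVec hP))).toContinuousLinearEquiv

theorem exists_contDiffAt_grad_rightInverse {u : Fin n → ℝ} (hφ : ContDiffAt ℝ 3 φ u)
    (hP : IsUnit (hess φ u)) :
    ∃ ψ : (Fin n → ℝ) → Fin n → ℝ, ψ (grad φ u) = u ∧ ContDiffAt ℝ 2 ψ (grad φ u) ∧
      HasFDerivAt ψ (hess φ u)⁻¹.mulVecLin.toContinuousLinearMap (grad φ u) ∧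
      ∀ᶠ z in 𝓝 (grad φ u), grad φ (ψ z) = z := by
  have hsmooth := contDiffAt_grad hφ
  have hderiv : HasFDerivAt (grad φ) (mulVecEquiv hP : (Fin n → ℝ) →L[ℝ] Fin n → ℝ) u :=
    hasFDerivAt_grad (hφ.of_le (by norm_num))
  have hstrict := hsmooth.hasStrictFDerivAt' hderiv (by norm_num)
  exact ⟨hsmooth.localInverse hderiv (by norm_num),
    hsmooth.localInverse_apply_image hderiv (by norm_num),
    hsmooth.to_localInverse hderiv (by norm_num),
    hstrict.to_localInverse.hasFDerivAt, hstrict.eventually_right_inverse⟩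

end Gradient

section MaxFunction

variable {n p : ℕ} {φ : (Fin n → ℝ) → ℝ} {D : Set (Fin n → ℝ)} {A : Matrix (Fin p) (Fin n) ℝ}
  {x y : Fin p → ℝ} {us : Fin n → ℝ}

theorem mem_maxDom_of_forall_le {M : ℝ} (h : ∀ u ∈ D, u ⬝ᵥ (Aᵀ *ᵥ x) - φ u ≤ M) :
    x ∈ maxDom φ D A :=
  ⟨-M, Set.forall_mem_image.2 fun u hu => by linarith [h u hu]⟩

theorem le_maxFun (hx : x ∈ maxDom φ D A) {u : Fin n → ℝ} (hu : u ∈ D) :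
    u ⬝ᵥ (Aᵀ *ᵥ x) - φ u ≤ maxFun φ D A x := by
  obtain ⟨M, hM⟩ := hx
  have hbdd : BddAbove ((fun u => u ⬝ᵥ (Aᵀ *ᵥ x) - φ u) '' D) :=
    ⟨-M, Set.forall_mem_image.2 fun v hv => by linarith [Set.forall_mem_image.1 hM hv]⟩
  exact le_csSup hbdd ⟨u, hu, rfl⟩

theorem maxFun_le (hD : D.Nonempty) {M : ℝ} (h : ∀ u ∈ D, u ⬝ᵥ (Aᵀ *ᵥ x) - φ u ≤ M) :
    maxFun φ D A x ≤ M :=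
  csSup_le (hD.image _) (Set.forall_mem_image.2 h)

theorem convexOn_maxFun (hD : D.Nonempty) : ConvexOn ℝ (maxDom φ D A) (maxFun φ D A) := by
  have hcomb {x y : Fin p → ℝ} (hx : x ∈ maxDom φ D A) (hy : y ∈ maxDom φ D A) {a b : ℝ}
      (ha : 0 ≤ a) (hb : 0 ≤ b) (hab : a + b = 1) (u : Fin n → ℝ) (hu : u ∈ D) :
      u ⬝ᵥ (Aᵀ *ᵥ (a • x + b • y)) - φ u ≤ a • maxFun φ D A x + b • maxFun φ D A y := by
    calc u ⬝ᵥ (Aᵀ *ᵥ (a • x + b • y)) - φ u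
        = a * (u ⬝ᵥ (Aᵀ *ᵥ x) - φ u) + b * (u ⬝ᵥ (Aᵀ *ᵥ y) - φ u) := by
          rw [Matrix.mulVec_add, Matrix.mulVec_smul, Matrix.mulVec_smul, dotProduct_add,
            dotProduct_smul, dotProduct_smul, smul_eq_mul, smul_eq_mul]
          linear_combination φ u * hab
      _ ≤ a • maxFun φ D A x + b • maxFun φ D A y := by
          simp only [smul_eq_mul]
          gcongr
          exacts [le_maxFun hx hu, le_maxFun hy hu]
  exact ⟨fun x hx y hy a b ha hb hab => mem_maxDom_of_forall_le (hcomb hx hy ha hb hab),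
    fun x hx y hy a b ha hb hab => maxFun_le hD (hcomb hx hy ha hb hab)⟩

theorem mulVec_dotProduct (u : Fin n → ℝ) (z : Fin p → ℝ) :
    (A *ᵥ u) ⬝ᵥ z = u ⬝ᵥ (Aᵀ *ᵥ z) := by
  rw [Matrix.dotProduct_transpose_mulVec, dotProduct_comm]

theorem isExactSolution_iff_isMinOn : IsExactSolution φ D A x us ↔
    us ∈ D ∧ IsMinOn (fun u => φ u - dotProductCLM (Aᵀ *ᵥ x) u) D us := by
  simp only [IsExactSolution, isMinOn_iff, dotProductCLM_apply, dotProduct_comm (Aᵀ *ᵥ x)]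

namespace IsExactSolution

variable (h : IsExactSolution φ D A x us)
include h

theorem mem_maxDom : x ∈ maxDom φ D A :=
  ⟨_, Set.forall_mem_image.2 h.2⟩

theorem maxFun_eq : maxFun φ D A x = us ⬝ᵥ (Aᵀ *ᵥ x) - φ us :=
  (maxFun_le ⟨us, h.1⟩ fun u hu => by linarith [h.2 u hu]).antisymm (le_maxFun h.mem_maxDom h.1)

theorem maxFun_add_dotProduct_le (hy : y ∈ maxDom φ D A) :
    maxFun φ D A x + (A *ᵥ us) ⬝ᵥ (y - x) ≤ maxFun φ D A y := by
  have hle := le_maxFun hy h.1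
  rw [h.maxFun_eq, mulVec_dotProduct, Matrix.mulVec_sub, dotProduct_sub]
  linarith

end IsExactSolution

end MaxFunction

section Duality

variable {n p : ℕ} {φ : (Fin n → ℝ) → ℝ} {D : Set (Fin n → ℝ)} {A : Matrix (Fin p) (Fin n) ℝ}
  {x y : Fin p → ℝ} {us : Fin n → ℝ}

/-- `A[∇²φ(u)]⁻¹Aᵀ`, which is the Hessian of `f` at `x` when `u = u*(x)`, and `H(x)` when
`u = ũ*(x)`. -/
noncomputable def dualHess (φ : (Fin n → ℝ) → ℝ) (A : Matrix (Fin p) (Fin n) ℝ) (u : Fin n → ℝ) :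
    Matrix (Fin p) (Fin p) ℝ :=
  A * (hess φ u)⁻¹ * Aᵀ

theorem wnorm_dualHess (u : Fin n → ℝ) (z : Fin p → ℝ) :
    wnorm (dualHess φ A u) z = wnormDual (hess φ u) (Aᵀ *ᵥ z) :=
  wnorm_mul_mul_transpose A _ z

namespace IsStandardSelfConcordant

variable (hφ : IsStandardSelfConcordant φ D)
include hφ

theorem isExactSolution_iff (hus : us ∈ D) :
    IsExactSolution φ D A x us ↔ grad φ us = Aᵀ *ᵥ x := by
  rw [isExactSolution_iff_isMinOn, and_iff_right hus, hφ.isSelfConcordantOn.isMinOn_sub_iff hus,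
    fderiv_eq_dotProductCLM_iff]

theorem fderiv_apply_of_isExactSolution (h : IsExactSolution φ D A x us) (d : Fin n → ℝ) :
    fderiv ℝ φ us d = d ⬝ᵥ (Aᵀ *ᵥ x) := by
  rw [← grad_dotProduct, (hφ.isExactSolution_iff h.1).1 h, dotProduct_comm]

theorem posSemidef_dualHess {u : Fin n → ℝ} (hu : u ∈ D) : (dualHess φ A u).PosSemidef :=
  (hφ.hess_posDef u hu).inv.posSemidef.mul_mul_conjTranspose_same A

theorem posDef_dualHess (hA : A.rank = p) {u : Fin n → ℝ} (hu : u ∈ D) :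
    (dualHess φ A u).PosDef :=
  posDef_mul_mul_transpose (by rwa [Fintype.card_fin]) (hφ.hess_posDef u hu).inv

/-- The maximum defining `f(y)` is tested at the point of the Dikin ellipsoid of `us` in the
direction `∇²φ(us)⁻¹ Aᵀ(y - x)` where the upper bound on `φ` gives the best value. -/
theorem maxFun_add_omega_le (h : IsExactSolution φ D A x us) (hy : y ∈ maxDom φ D A) :
    maxFun φ D A x + (A *ᵥ us) ⬝ᵥ (y - x) + omega (wnorm (dualHess φ A us) (y - x)) ≤
      maxFun φ D A y := by
  have hP := hφ.hess_posDef us h.1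
  rw [wnorm_dualHess, mulVec_dotProduct]
  set w := Aᵀ *ᵥ (y - x) with hw
  set r := wnormDual (hess φ us) w
  have hr0 : 0 ≤ r := wnorm_nonneg _ _
  set d := (1 + r)⁻¹ • ((hess φ us)⁻¹ *ᵥ w) with hd
  have hnorm : localNorm φ us (us + d - us) = r / (1 + r) := by
    rw [add_sub_cancel_left, hd, localNorm_smul _ _ _ (by positivity), ← wnorm_hess,
      wnorm_inv_mulVec hP.isUnit, inv_mul_eq_div]
  have hlt : localNorm φ us (us + d - us) < 1 := by
    rw [hnorm, div_lt_one (by positivity)]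
    linarith
  have hmem := hφ.isSelfConcordantOn.mem_of_localNorm_lt_one hφ.closed_epigraph h.1 hlt
  have hupper := hφ.isSelfConcordantOn.le_add_omegaStar_localNorm h.1 hmem hlt
  rw [hnorm, add_sub_cancel_left, hφ.fderiv_apply_of_isExactSolution h] at hupper
  have hdw : d ⬝ᵥ w = r / (1 + r) * r := by
    have hsq : w ⬝ᵥ ((hess φ us)⁻¹ *ᵥ w) = r ^ 2 := (wnorm_sq hP.inv.posSemidef w).symm
    rw [hd, smul_dotProduct, dotProduct_comm _ w, hsq, smul_eq_mul]
    ring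
  have hAy : Aᵀ *ᵥ y = Aᵀ *ᵥ x + w := by rw [hw, Matrix.mulVec_sub, add_sub_cancel]
  have htest := le_maxFun hy hmem
  rw [hAy, add_dotProduct, dotProduct_add, dotProduct_add, hdw] at htest
  rw [h.maxFun_eq, ← mul_sub_omegaStar_eq_omega (by linarith)]
  linarith

theorem dotProduct_sub_le_add_omegaStar (h : IsExactSolution φ D A x us)
    (hr : wnorm (dualHess φ A us) (y - x) < 1) {u : Fin n → ℝ} (hu : u ∈ D) :
    u ⬝ᵥ (Aᵀ *ᵥ y) - φ u ≤ maxFun φ D A x + (A *ᵥ us) ⬝ᵥ (y - x)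
      + omegaStar (wnorm (dualHess φ A us) (y - x)) := by
  rw [wnorm_dualHess] at hr ⊢
  have hlower := hφ.isSelfConcordantOn.add_omega_localNorm_le h.1 hu
  rw [hφ.fderiv_apply_of_isExactSolution h, sub_dotProduct] at hlower
  have hCS := (le_abs_self _).trans (abs_dotProduct_le_wnorm_mul_wnormDual
    (hφ.hess_posDef us h.1) (u - us) (Aᵀ *ᵥ (y - x)))
  rw [wnorm_hess, sub_dotProduct] at hCS
  have hYoung := mul_sub_omega_le_omegaStar hr
    (neg_one_lt_zero.trans_le (localNorm_nonneg φ us (u - us)))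
  have hAy : u ⬝ᵥ (Aᵀ *ᵥ y) = u ⬝ᵥ (Aᵀ *ᵥ x) + u ⬝ᵥ (Aᵀ *ᵥ (y - x)) := by
    rw [← dotProduct_add, ← Matrix.mulVec_add, add_sub_cancel]
  rw [hAy, mulVec_dotProduct, h.maxFun_eq]
  linarith

theorem exists_solutionMap (h : IsExactSolution φ D A x us) :
    ∃ v : (Fin p → ℝ) → Fin n → ℝ, v x = us ∧ ContDiffAt ℝ 2 v x ∧
      HasFDerivAt v ((hess φ us)⁻¹ * Aᵀ).mulVecLin.toContinuousLinearMap x ∧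
      ∀ᶠ y in 𝓝 x, IsExactSolution φ D A y (v y) := by
  obtain ⟨ψ, hψus, hψ, hψ', hgrad⟩ := exists_contDiffAt_grad_rightInverse
    (hφ.isSelfConcordantOn.contDiffAt h.1) (hφ.hess_posDef us h.1).isUnit
  let L : (Fin p → ℝ) →L[ℝ] Fin n → ℝ := Aᵀ.mulVecLin.toContinuousLinearMap
  have hL : grad φ us = L x := (hφ.isExactSolution_iff h.1).1 h
  rw [hL] at hψus hψ hψ' hgrad
  have hsmooth : ContDiffAt ℝ 2 (ψ ∘ L) x := hψ.comp x L.contDiff.contDiffAt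
  refine ⟨ψ ∘ L, hψus, hsmooth, ?_, ?_⟩
  · exact (hψ'.comp x L.hasFDerivAt).congr_fderiv
      (ContinuousLinearMap.ext fun z => Matrix.mulVec_mulVec z (hess φ us)⁻¹ Aᵀ)
  · have hmem : ∀ᶠ y in 𝓝 x, ψ (L y) ∈ D :=
      hsmooth.continuousAt.eventually
        (hφ.isOpen.mem_nhds (by rw [Function.comp_apply, hψus]; exact h.1))
    filter_upwards [hmem, L.continuous.continuousAt.eventually hgrad] with y hy hgrady
    exact (hφ.isExactSolution_iff hy).2 hgrady

theorem contDiffAt_maxFun (h : IsExactSolution φ D A x us) : ContDiffAt ℝ 2 (maxFun φ D A) x := by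
  obtain ⟨v, hvx, hv, -, hsol⟩ := hφ.exists_solutionMap h
  have hφv : ContDiffAt ℝ 2 (fun y => φ (v y)) x :=
    ContDiffAt.comp x (hvx.symm ▸ hφ.isSelfConcordantOn.contDiffAt_two h.1) hv
  have hAy (i : Fin n) : ContDiff ℝ 2 fun y : Fin p → ℝ => (Aᵀ *ᵥ y) i :=
    ((ContinuousLinearMap.proj i : (Fin n → ℝ) →L[ℝ] ℝ) ∘L
      Aᵀ.mulVecLin.toContinuousLinearMap).contDiff
  have hvalue : ContDiffAt ℝ 2 (fun y => v y ⬝ᵥ (Aᵀ *ᵥ y) - φ (v y)) x :=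
    (ContDiffAt.sum fun i _ => (contDiffAt_pi.1 hv i).mul (hAy i).contDiffAt).sub hφv
  exact hvalue.congr_of_eventuallyEq (hsol.mono fun y hy => hy.maxFun_eq)

theorem grad_maxFun (h : IsExactSolution φ D A x us) : grad (maxFun φ D A) x = A *ᵥ us := by
  obtain ⟨v, -, -, -, hsol⟩ := hφ.exists_solutionMap h
  exact grad_eq_of_eventually_le ((hφ.contDiffAt_maxFun h).differentiableAt (by norm_num))
    (hsol.mono fun y hy => h.maxFun_add_dotProduct_le hy.mem_maxDom)

theorem hess_maxFun (h : IsExactSolution φ D A x us) :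
    hess (maxFun φ D A) x = dualHess φ A us := by
  obtain ⟨v, -, -, hv', hsol⟩ := hφ.exists_solutionMap h
  have hgrad : grad (maxFun φ D A) =ᶠ[𝓝 x] fun y => A *ᵥ v y :=
    hsol.mono fun y hy => hφ.grad_maxFun hy
  have hderiv := (A.mulVecLin.toContinuousLinearMap.hasFDerivAt.comp x hv').congr_of_eventuallyEq
    hgrad
  have heq := (hasFDerivAt_grad (hφ.contDiffAt_maxFun h)).unique hderiv
  refine Matrix.ext_iff_mulVec.2 fun z => ?_
  rw [dualHess, Matrix.mul_assoc, ← Matrix.mulVec_mulVec]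
  exact DFunLike.congr_fun heq z

end IsStandardSelfConcordant

end Duality

section InexactSolutions

variable {n p : ℕ} {φ : (Fin n → ℝ) → ℝ} {D : Set (Fin n → ℝ)} {A : Matrix (Fin p) (Fin n) ℝ}
  {x y : Fin p → ℝ} {u us v : Fin n → ℝ} {δ : ℝ}

theorem one_add_div_one_sub_mul (hδ : δ < 1) : (1 + δ / (1 - δ)) * (1 - δ) = 1 := by
  field_simp [(sub_pos.2 hδ).ne']
  ring

theorem le_div_one_sub (h0 : 0 ≤ δ) (hδ : δ < 1) : δ ≤ δ / (1 - δ) :=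
  le_div_self h0 (sub_pos.2 hδ) (by linarith)

theorem lt_half_of_acc0_le_one (h0 : 0 ≤ δ) (hδ : δ < 1) (hacc : acc0 δ (δ / (1 - δ)) ≤ 1) :
    δ < 1 / 2 := by
  rw [acc0] at hacc
  linarith [le_div_one_sub h0 hδ]

theorem div_one_sub_lt_one (hδ : δ < 1 / 2) : δ / (1 - δ) < 1 := by
  rw [div_lt_one (by linarith)]
  linarith

theorem acc0_le_one_of_le (hδ : δ ≤ 0.292) : acc0 δ (δ / (1 - δ)) ≤ 1 := by
  have hpos : 0 < 1 - δ := by norm_num at hδ; linarith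
  rw [acc0, ← le_sub_iff_add_le', div_le_iff₀ hpos]
  norm_num at hδ
  nlinarith

namespace IsStandardSelfConcordant

variable (hφ : IsStandardSelfConcordant φ D)
include hφ

theorem posSemidef_hess_sub (hu : u ∈ D) (hv : v ∈ D) (h : wnorm (hess φ u) (u - v) ≤ δ)
    (hδ : δ < 1) :
    (hess φ u - (1 - δ) ^ 2 • hess φ v).PosSemidef ∧
      (hess φ v - (1 - δ) ^ 2 • hess φ u).PosSemidef := by
  have hs := hφ.isSelfConcordantOn
  have hHu := (hφ.hess_posDef u hu).isHermitian
  have hHv := (hφ.hess_posDef v hv).isHermitian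
  rw [wnorm_hess, ← neg_sub v u, localNorm_neg] at h
  have hle : (1 - δ) ^ 2 ≤ (1 - localNorm φ u (v - u)) ^ 2 :=
    pow_le_pow_left₀ (by linarith) (by linarith) 2
  have hcmp := hs.hessForm_comparison hu hv (h.trans_lt hδ)
  rw [posSemidef_sub_smul_iff hHv hHu, posSemidef_sub_smul_iff hHu hHv]
  simp only [dotProduct_hess_mulVec]
  exact ⟨fun w => (mul_le_mul_of_nonneg_right hle (hs.hessForm_nonneg hv w)).trans (hcmp w).1,
    fun w => (mul_le_mul_of_nonneg_right hle (hs.hessForm_nonneg hu w)).trans (hcmp w).2⟩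

theorem posSemidef_dualHess_sub (hu : u ∈ D) (hv : v ∈ D) (h : wnorm (hess φ u) (u - v) ≤ δ)
    (hδ : δ < 1) :
    (dualHess φ A u - (1 - δ) ^ 2 • dualHess φ A v).PosSemidef ∧
      (dualHess φ A v - (1 - δ) ^ 2 • dualHess φ A u).PosSemidef := by
  have hcmp := hφ.posSemidef_hess_sub hu hv h hδ
  have hHu := hφ.hess_posDef u hu
  have hHv := hφ.hess_posDef v hv
  exact ⟨posSemidef_mul_mul_transpose_sub_smul A
      (posSemidef_inv_sub_smul_inv hHu hHv (sq_nonneg _) hcmp.2),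
    posSemidef_mul_mul_transpose_sub_smul A
      (posSemidef_inv_sub_smul_inv hHv hHu (sq_nonneg _) hcmp.1)⟩

theorem wnorm_dualHess_le (hu : u ∈ D) (hv : v ∈ D) (h : wnorm (hess φ u) (u - v) ≤ δ)
    (hδ : δ < 1) (z : Fin p → ℝ) :
    (1 - δ) * wnorm (dualHess φ A u) z ≤ wnorm (dualHess φ A v) z ∧
      (1 - δ) * wnorm (dualHess φ A v) z ≤ wnorm (dualHess φ A u) z := by
  have hcmp := hφ.posSemidef_dualHess_sub (A := A) hu hv h hδ
  have hHu := (hφ.posSemidef_dualHess (A := A) hu).isHermitian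
  have hHv := (hφ.posSemidef_dualHess (A := A) hv).isHermitian
  exact ⟨mul_wnorm_le_wnorm hHu hHv (by linarith) hcmp.2 z,
    mul_wnorm_le_wnorm hHv hHu (by linarith) hcmp.1 z⟩

theorem maxFun_sub_le (hu : u ∈ D) (hus : IsExactSolution φ D A x us)
    (h : wnorm (hess φ u) (u - us) ≤ δ) (hδ : δ < 1 / 2) :
    maxFun φ D A x - (u ⬝ᵥ (Aᵀ *ᵥ x) - φ u) ≤ omegaStar (δ / (1 - δ)) := by
  have hs := hφ.isSelfConcordantOn
  have hnorm : localNorm φ us (u - us) ≤ δ / (1 - δ) := by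
    have hcmp := mul_wnorm_le_wnorm (hφ.hess_posDef us hus.1).isHermitian
      (hφ.hess_posDef u hu).isHermitian (by linarith)
      (hφ.posSemidef_hess_sub hu hus.1 h (by linarith)).1 (u - us)
    rw [le_div_iff₀ (by linarith), ← wnorm_hess]
    linarith
  have hlt := div_one_sub_lt_one hδ
  have hnonneg := localNorm_nonneg φ us (u - us)
  have hupper := hs.le_add_omegaStar_localNorm hus.1 hu (hnorm.trans_lt hlt)
  rw [hφ.fderiv_apply_of_isExactSolution hus, sub_dotProduct] at hupper
  have hmono := monotoneOn_omegaStar ⟨hnonneg, hnorm.trans_lt hlt⟩ ⟨hnonneg.trans hnorm, hlt⟩ hnorm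
  rw [hus.maxFun_eq]
  linarith

theorem abs_mulVec_sub_dotProduct_le (hu : u ∈ D) (h : wnorm (hess φ u) (u - us) ≤ δ)
    (z : Fin p → ℝ) :
    |(A *ᵥ u - A *ᵥ us) ⬝ᵥ z| ≤ δ * wnorm (dualHess φ A u) z := by
  rw [← Matrix.mulVec_sub, mulVec_dotProduct, wnorm_dualHess]
  exact (abs_dotProduct_le_wnorm_mul_wnormDual (hφ.hess_posDef u hu) _ _).trans
    (mul_le_mul_of_nonneg_right h (wnorm_nonneg _ _))

theorem isDeltaSolution_of_wnormDual_le (hδ : 0 ≤ δ) (hu : u ∈ D)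
    (h : wnormDual (hess φ u) (grad φ u - Aᵀ *ᵥ x) ≤ δ / (1 + δ)) :
    IsDeltaSolution φ D A x δ u := by
  have hs := hφ.isSelfConcordantOn
  have hlt : δ / (1 + δ) < 1 := by
    rw [div_lt_one (by positivity)]
    linarith
  have hdual (w : Fin n → ℝ) :
      dotProductCLM (Aᵀ *ᵥ x) w - fderiv ℝ φ u w ≤ δ / (1 + δ) * localNorm φ u w :=
    calc dotProductCLM (Aᵀ *ᵥ x) w - fderiv ℝ φ u w = -(w ⬝ᵥ (grad φ u - Aᵀ *ᵥ x)) := by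
          rw [dotProductCLM_apply, ← grad_dotProduct, dotProduct_sub, dotProduct_comm w,
            dotProduct_comm w, neg_sub]
      _ ≤ wnorm (hess φ u) w * wnormDual (hess φ u) (grad φ u - Aᵀ *ᵥ x) :=
          (neg_le_abs _).trans (abs_dotProduct_le_wnorm_mul_wnormDual (hφ.hess_posDef u hu) _ _)
      _ ≤ δ / (1 + δ) * localNorm φ u w := by
          rw [mul_comm, ← wnorm_hess]
          exact mul_le_mul_of_nonneg_right h (wnorm_nonneg _ _)
  obtain ⟨us, hus, hmin⟩ := hs.exists_isMinOn_sub hφ.closed_epigraph hu hlt hdual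
  refine ⟨hu, us, isExactSolution_iff_isMinOn.2 ⟨hus, hmin⟩, ?_⟩
  have hradius : δ / (1 + δ) / (1 - δ / (1 + δ)) = δ := by
    field_simp
    ring
  rw [wnorm_hess, ← neg_sub us u, localNorm_neg, ← hradius]
  exact hs.localNorm_sub_le_of_isMinOn hu hus (by positivity) hlt hdual hmin

end IsStandardSelfConcordant

end InexactSolutions

section Oracle

variable {n p : ℕ} {φ : (Fin n → ℝ) → ℝ} {D : Set (Fin n → ℝ)} {A : Matrix (Fin p) (Fin n) ℝ}
  {x y : Fin p → ℝ} {u us : Fin n → ℝ} {δ : ℝ}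

namespace IsStandardSelfConcordant

variable (hφ : IsStandardSelfConcordant φ D)
include hφ

theorem wnorm_dualHess_mem_Icc (hu : u ∈ D) (hus : us ∈ D) (h : wnorm (hess φ u) (u - us) ≤ δ)
    (h0 : 0 ≤ δ) (hδ : δ < 1) (z : Fin p → ℝ) :
    wnorm (dualHess φ A us) z ∈ Set.Icc ((1 - δ / (1 - δ)) * wnorm (dualHess φ A u) z)
      ((1 + δ / (1 - δ)) * wnorm (dualHess φ A u) z) := by
  obtain ⟨hlower, hupper⟩ := hφ.wnorm_dualHess_le (A := A) hu hus h hδ z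
  have hle := le_div_one_sub h0 hδ
  constructor
  · exact (mul_le_mul_of_nonneg_right (by linarith) (wnorm_nonneg _ _)).trans hlower
  · calc wnorm (dualHess φ A us) z
        = (1 + δ / (1 - δ)) * ((1 - δ) * wnorm (dualHess φ A us) z) := by
          rw [← mul_assoc, one_add_div_one_sub_mul hδ, one_mul]
      _ ≤ _ := mul_le_mul_of_nonneg_left hupper (by linarith)

theorem omega_le_maxFun_sub (hu : u ∈ D) (hus : IsExactSolution φ D A x us)
    (h : wnorm (hess φ u) (u - us) ≤ δ) (h0 : 0 ≤ δ) (hδ : δ < 1)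
    (hacc : acc0 δ (δ / (1 - δ)) ≤ 1) (hy : y ∈ maxDom φ D A) :
    omega ((1 - acc0 δ (δ / (1 - δ))) * wnorm (dualHess φ A u) (y - x)) ≤
      maxFun φ D A y
        - (u ⬝ᵥ (Aᵀ *ᵥ x) - φ u - omegaStar (δ / (1 - δ)) + psiLower δ (δ / (1 - δ)))
        - (A *ᵥ u) ⬝ᵥ (y - x) := by
  have hhalf := lt_half_of_acc0_le_one h0 hδ hacc
  have hδ₃ := div_one_sub_lt_one hhalf
  have hvalue := hφ.maxFun_sub_le hu hus h hhalf
  have hvalue0 := le_maxFun hus.mem_maxDom hu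
  have hlinear := le_of_abs_le (hφ.abs_mulVec_sub_dotProduct_le (A := A) hu h (y - x))
  rw [sub_dotProduct] at hlinear
  have hexact := hφ.maxFun_add_omega_le hus hy
  have ht := wnorm_nonneg (dualHess φ A u) (y - x)
  have hnorm := (hφ.wnorm_dualHess_mem_Icc (A := A) hu hus.1 h h0 hδ (y - x)).1
  have hmono := monotoneOn_omega (Set.mem_Ici.2 (mul_nonneg (by linarith) ht))
    (Set.mem_Ici.2 (wnorm_nonneg _ _)) hnorm
  have hgap := psiLower_le_lowerGap h0 hδ₃ hacc ht
  rw [lowerGap] at hgap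
  linarith

theorem mem_maxDom_and_maxFun_sub_le (hu : u ∈ D) (hus : IsExactSolution φ D A x us)
    (h : wnorm (hess φ u) (u - us) ≤ δ) (h0 : 0 ≤ δ) (hδ : δ < 1 / 2)
    (ht₁ : (1 + acc0 δ (δ / (1 - δ))) * wnorm (dualHess φ A u) (y - x) < 1) :
    y ∈ maxDom φ D A ∧
      maxFun φ D A y
          - (u ⬝ᵥ (Aᵀ *ᵥ x) - φ u - omegaStar (δ / (1 - δ)) + psiLower δ (δ / (1 - δ)))
          - (A *ᵥ u) ⬝ᵥ (y - x) ≤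
        omegaStar ((1 + acc0 δ (δ / (1 - δ))) * wnorm (dualHess φ A u) (y - x))
          + acc1 (omegaStar (δ / (1 - δ))) δ (δ / (1 - δ)) := by
  have hle := le_div_one_sub h0 (by linarith)
  have ht := wnorm_nonneg (dualHess φ A u) (y - x)
  have hnorm := (hφ.wnorm_dualHess_mem_Icc (A := A) hu hus.1 h h0 (by linarith) (y - x)).2
  have hlt : (1 + δ / (1 - δ)) * wnorm (dualHess φ A u) (y - x) < 1 :=
    (mul_le_mul_of_nonneg_right (by rw [acc0]; linarith) ht).trans_lt ht₁
  have hs := wnorm_nonneg (dualHess φ A us) (y - x)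
  have hexact := fun v hv =>
    hφ.dotProduct_sub_le_add_omegaStar hus (hnorm.trans_lt hlt) (u := v) hv
  refine ⟨mem_maxDom_of_forall_le hexact, ?_⟩
  have hupper := maxFun_le ⟨u, hu⟩ hexact
  have hvalue := hφ.maxFun_sub_le hu hus h hδ
  have hlinear := neg_le_of_abs_le (hφ.abs_mulVec_sub_dotProduct_le (A := A) hu h (y - x))
  rw [sub_dotProduct] at hlinear
  have hmono := monotoneOn_omegaStar ⟨hs, hnorm.trans_lt hlt⟩ ⟨hs.trans hnorm, hlt⟩ hnorm
  have hgap := upperGap_le_psiUpper h0 (h0.trans hle) ht ht₁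
  rw [upperGap] at hgap
  have hacc1 := le_max_right 0
    (2 * omegaStar (δ / (1 - δ)) + psiUpper δ (δ / (1 - δ)) - psiLower δ (δ / (1 - δ)))
  rw [← acc1] at hacc1
  linarith

theorem wnormDual_mulVec_sub_grad_le (hA : A.rank = p) (hu : u ∈ D)
    (hus : IsExactSolution φ D A x us) (h : wnorm (hess φ u) (u - us) ≤ δ) (h0 : 0 ≤ δ) :
    wnormDual (dualHess φ A u) (A *ᵥ u - grad (maxFun φ D A) x) ≤ δ := by
  rw [hφ.grad_maxFun hus]
  exact wnormDual_le (hφ.posDef_dualHess hA hu) h0 fun z =>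
    (le_abs_self _).trans (hφ.abs_mulVec_sub_dotProduct_le hu h z)

theorem posSemidef_dualHess_sub_hess (hu : u ∈ D) (hus : IsExactSolution φ D A x us)
    (h : wnorm (hess φ u) (u - us) ≤ δ) (h0 : 0 ≤ δ) (hδ : δ < 1 / 2) :
    (dualHess φ A u - (1 - δ / (1 - δ)) ^ 2 • hess (maxFun φ D A) x).PosSemidef := by
  have hle := le_div_one_sub h0 (by linarith)
  have hδ₃ := div_one_sub_lt_one hδ
  rw [hφ.hess_maxFun hus]
  exact posSemidef_sub_smul_of_le (hφ.posSemidef_dualHess hus.1)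
    (pow_le_pow_left₀ (by linarith) (by linarith) 2)
    (hφ.posSemidef_dualHess_sub hu hus.1 h (by linarith)).1

theorem posSemidef_hess_sub_dualHess (hu : u ∈ D) (hus : IsExactSolution φ D A x us)
    (h : wnorm (hess φ u) (u - us) ≤ δ) (hδ : δ < 1) :
    ((1 + δ / (1 - δ)) ^ 2 • hess (maxFun φ D A) x - dualHess φ A u).PosSemidef := by
  have hcmp := (hφ.posSemidef_dualHess_sub (A := A) hu hus.1 h hδ).2.smul
    (sq_nonneg (1 + δ / (1 - δ)))
  rwa [smul_sub, smul_smul, ← mul_pow, one_add_div_one_sub_mul hδ, one_pow, one_smul,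
    ← hφ.hess_maxFun hus] at hcmp

theorem isGlobalInexactOracle (hA : A.rank = p) (h0 : 0 ≤ δ) (hδ : δ < 1)
    (hacc : acc0 δ (δ / (1 - δ)) ≤ 1) {ut : (Fin p → ℝ) → Fin n → ℝ}
    (hut : ∀ x ∈ maxDom φ D A, IsDeltaSolution φ D A x δ (ut x)) :
    IsGlobalInexactOracle (maxFun φ D A) (maxDom φ D A)
      (fun x => approxVal φ A ut x - omegaStar (δ / (1 - δ)) + psiLower δ (δ / (1 - δ)))
      (approxGrad A ut) (approxHess φ A ut) (acc0 δ (δ / (1 - δ)))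
      (acc1 (omegaStar (δ / (1 - δ))) δ (δ / (1 - δ))) where
  convexOn := convexOn_maxFun hφ.nonempty
  acc₀ := ⟨by rw [acc0]; linarith [le_div_one_sub h0 hδ], hacc⟩
  acc₁ := le_max_left _ _
  oracle x hx := by
    obtain ⟨hu, us, hus, h⟩ := hut x hx
    refine ⟨hφ.posDef_dualHess hA hu, fun y hr => ?_⟩
    have hpos : 0 < 1 + acc0 δ (δ / (1 - δ)) := by
      rw [acc0]
      linarith [le_div_one_sub h0 hδ]
    obtain ⟨hy, hupper⟩ := hφ.mem_maxDom_and_maxFun_sub_le hu hus h h0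
      (lt_half_of_acc0_le_one h0 hδ hacc) ((lt_div_iff₀' hpos).1 hr)
    exact ⟨hy, hφ.omega_le_maxFun_sub hu hus h h0 hδ hacc hy, hupper⟩

end IsStandardSelfConcordant

end Oracle

end SCOracle

theorem lemma3p2_general {n p : ℕ} (φ : (Fin n → ℝ) → ℝ) (D : Set (Fin n → ℝ))
    (A : Matrix (Fin p) (Fin n) ℝ) (hφ : SCOracle.IsStandardSelfConcordant φ D) :
    (∀ δ : ℝ, 0 ≤ δ → δ < 1 → SCOracle.acc0 δ (δ / (1 - δ)) ≤ 1 →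
      ∀ ut : (Fin p → ℝ) → Fin n → ℝ,
        (∀ x ∈ SCOracle.maxDom φ D A, SCOracle.IsDeltaSolution φ D A x δ (ut x)) →
        (A.rank = p → SCOracle.IsGlobalInexactOracle
          (SCOracle.maxFun φ D A) (SCOracle.maxDom φ D A)
          (fun x => SCOracle.approxVal φ A ut x - SCOracle.omegaStar (δ / (1 - δ))
            + SCOracle.psiLower δ (δ / (1 - δ)))
          (SCOracle.approxGrad A ut) (SCOracle.approxHess φ A ut)
          (SCOracle.acc0 δ (δ / (1 - δ)))
          (SCOracle.acc1 (SCOracle.omegaStar (δ / (1 - δ))) δ (δ / (1 - δ)))) ∧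
        ∀ x ∈ SCOracle.maxDom φ D A,
          ContDiffAt ℝ 2 (SCOracle.maxFun φ D A) x ∧
          (A.rank = p → SCOracle.wnormDual (SCOracle.approxHess φ A ut x)
            (SCOracle.approxGrad A ut x - SCOracle.grad (SCOracle.maxFun φ D A) x) ≤ δ) ∧
          (SCOracle.approxHess φ A ut x
            - (1 - δ / (1 - δ)) ^ 2 • SCOracle.hess (SCOracle.maxFun φ D A) x).PosSemidef ∧
          ((1 + δ / (1 - δ)) ^ 2 • SCOracle.hess (SCOracle.maxFun φ D A) x
            - SCOracle.approxHess φ A ut x).PosSemidef) ∧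
    (∀ δ : ℝ, 0 ≤ δ → ∀ x : Fin p → ℝ, ∀ u ∈ D,
      SCOracle.wnormDual (SCOracle.hess φ u) (SCOracle.grad φ u - Aᵀ *ᵥ x) ≤ δ / (1 + δ) →
      SCOracle.IsDeltaSolution φ D A x δ u) := by
  refine ⟨fun δ h0 hδ hacc ut hut =>
      ⟨fun hA => hφ.isGlobalInexactOracle hA h0 hδ hacc hut, fun x hx => ?_⟩,
    fun δ h0 x u hu h => hφ.isDeltaSolution_of_wnormDual_le h0 hu h⟩
  obtain ⟨hu, us, hus, h⟩ := hut x hx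
  have hhalf := SCOracle.lt_half_of_acc0_le_one h0 hδ hacc
  exact ⟨hφ.contDiffAt_maxFun hus, fun hA => hφ.wnormDual_mulVec_sub_grad_le hA hu hus h h0,
    hφ.posSemidef_dualHess_sub_hess hu hus h h0 hhalf, hφ.posSemidef_hess_sub_dualHess hu hus h hδ⟩

theorem lemma3p2 {n p : ℕ} (φ : (Fin n → ℝ) → ℝ) (D : Set (Fin n → ℝ))
    (A : Matrix (Fin p) (Fin n) ℝ) (hφ : SCOracle.IsStandardSelfConcordant φ D) :
    (A.rank = p →
      ∀ δ : ℝ, 0 ≤ δ → δ ≤ 0.292 →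
      ∀ ut : (Fin p → ℝ) → Fin n → ℝ,
        (∀ x ∈ SCOracle.maxDom φ D A, SCOracle.IsDeltaSolution φ D A x δ (ut x)) →
        SCOracle.IsGlobalInexactOracle
          (SCOracle.maxFun φ D A) (SCOracle.maxDom φ D A)
          (fun x => SCOracle.approxVal φ A ut x - SCOracle.omegaStar (δ / (1 - δ))
            + SCOracle.psiLower δ (δ / (1 - δ)))
          (SCOracle.approxGrad A ut) (SCOracle.approxHess φ A ut)
          (SCOracle.acc0 δ (δ / (1 - δ)))
          (SCOracle.acc1 (SCOracle.omegaStar (δ / (1 - δ))) δ (δ / (1 - δ))) ∧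
        ∀ x ∈ SCOracle.maxDom φ D A,
          ContDiffAt ℝ 2 (SCOracle.maxFun φ D A) x ∧
          SCOracle.wnormDual (SCOracle.approxHess φ A ut x)
            (SCOracle.approxGrad A ut x - SCOracle.grad (SCOracle.maxFun φ D A) x) ≤ δ ∧
          (SCOracle.approxHess φ A ut x
            - (1 - δ / (1 - δ)) ^ 2 • SCOracle.hess (SCOracle.maxFun φ D A) x).PosSemidef ∧
          ((1 + δ / (1 - δ)) ^ 2 • SCOracle.hess (SCOracle.maxFun φ D A) x
            - SCOracle.approxHess φ A ut x).PosSemidef) ∧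
    (∀ δ : ℝ, 0 ≤ δ → ∀ x ∈ SCOracle.maxDom φ D A, ∀ u ∈ D,
      SCOracle.wnormDual (SCOracle.hess φ u) (SCOracle.grad φ u - Aᵀ *ᵥ x) ≤ δ / (1 + δ) →
      SCOracle.IsDeltaSolution φ D A x δ u) := by
  refine ⟨fun hA δ h0 hδ ut hut => ?_,
    fun δ h0 x _ => (lemma3p2_general φ D A hφ).2 δ h0 x⟩
  obtain ⟨horacle, hderiv⟩ := (lemma3p2_general φ D A hφ).1 δ h0 (by norm_num at hδ; linarith)
    (SCOracle.acc0_le_one_of_le hδ) ut hut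
  exact ⟨horacle hA, fun x hx => (hderiv x hx).imp_right (And.imp_left (· hA))⟩
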